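/- **Corollary 4.4.** Let $X$ be a (real or complex) Banach space of cotype $r$ for some $2\le r<\infty$, with a 1-unconditional Schauder basis $\{e_l\}_{l\ge 1}$ (that is, $\|\sum_l \varepsilon_l t_l e_l\|\le\|\sum_l t_l e_l\|$ for all finitely supported scalars $t_l$ and all signs $\varepsilon_l=\pm1$), and let $1\le p<\infty$. Assume that no sequence $x_j=\sum_{l\in L_j}e_l$, where the sets $L_j\subset\mathbb N$ are pairwise disjoint with $|L_j|\le 3$, is equivalent to the unit vector basis of $l_p$. Say that $l_p$ is *crudely finitely sequence representable* in a sequence $\{y_i\}$ if there is a constant $C\ge1$ such that for every $n$ there is a set $B_n\subset\mathbb N$ with $|B_n|=n$ and $$C^{-1}\Big(\sum_{i\in B_n}|t_i|^p\Big)^{1/p}\le\Big\|\sum_{i\in B_n}t_iy_i\Big\|\le C\Big(\sum_{i\in B_n}|t_i|^p\Big)^{1/p}\quad\text{for all scalars }(t_i)_{i\in B_n}.$$ Assume moreover that one of the following holds: (i) $l_p$ is crudely finitely sequence representable in $\{e_l\}$, and $\{e_l\}$ either dominates or is dominated by the unit vector basis of $l_p$ (that is, there is $K$ such that $(\sum_l|t_l|^p)^{1/p}\le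 K\|\sum_l t_le_l\|$ for all finitely supported scalars $(t_l)$, or such that the reverse inequality $\|\sum_l t_le_l\|\le K(\sum_l|t_l|^p)^{1/p}$ holds for all of them); (ii) $l_p$ is crudely finitely sequence representable in every subsequence of $\{e_l\}$. Then $X$ contains a closed subspace $Y$ without local unconditional structure which admits an unconditional Schauder decomposition into 2-dimensional subspaces. Here a Banach space $Y$ has *local unconditional structure* if there is $C\ge1$ such that for every finite-dimensional subspace $Y_0\subset Y$ the inclusion $Y_0\to Y$ factors as $w_0u_0$ with operators $u_0:Y_0\to F$ and $w_0:F\to Y$, where $F$ is a Banach space with a 1-unconditional (finite or infinite) basis and $\|u_0\|\,\|w_0\|\le C$. A Schauder decomposition $\{Z_k\}$ is *unconditional* if there is $C$ such that $\|\sum_k\varepsilon_kz_k\|\le C\|\sum_kz_k\|$ for all finite sequences $z_k\in Z_k$ and all signs $\varepsilon_k=\pm1$. -/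

import Mathlib

open Filter Topology

universe u v

section Unconditionality

/-- A family `x` in a normed space is unconditional with constant `C` if changing the signs of the
coefficients of a finite linear combination increases its norm at most by the factor `C`. -/
def IsUnconditionalWith (𝕜 : Type v) {X : Type u} {β : Type*} [RCLike 𝕜] [NormedAddCommGroup X]
    [NormedSpace 𝕜 X] (C : ℝ) (x : β → X) : Prop :=
  ∀ (s : Finset β) (t : β → 𝕜) (ε : β → ℤˣ),
    ‖∑ i ∈ s, (ε i : ℤ) • t i • x i‖ ≤ C * ‖∑ i ∈ s, t i • x i‖

/-- A Schauder decomposition: a sequence of closed subspaces `Z k` such that every vector is, in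
exactly one way, the sum of a convergent series `∑ z k` with `z k ∈ Z k`. -/
def IsSchauderDecomposition {𝕜 : Type v} {Y : Type u} [RCLike 𝕜] [NormedAddCommGroup Y]
    [NormedSpace 𝕜 Y] (Z : ℕ → Submodule 𝕜 Y) : Prop :=
  (∀ k, IsClosed (Z k : Set Y)) ∧
    ∀ y : Y, ∃! z : ℕ → Y, (∀ k, z k ∈ Z k) ∧
      Tendsto (fun n => ∑ k ∈ Finset.range n, z k) atTop (𝓝 y)

/-- `Y` has an unconditional Schauder decomposition into `d`-dimensional subspaces. -/
def HasUnconditionalDecomposition (𝕜 : Type v) (Y : Type u) [RCLike 𝕜] [NormedAddCommGroup Y]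
    [NormedSpace 𝕜 Y] (d : ℕ) : Prop :=
  ∃ Z : ℕ → Submodule 𝕜 Y, IsSchauderDecomposition Z ∧ (∀ k, Module.finrank 𝕜 (Z k) = d) ∧
    ∃ C : ℝ, ∀ (s : Finset ℕ) (z : ℕ → Y) (ε : ℕ → ℤˣ), (∀ k, z k ∈ Z k) →
      ‖∑ k ∈ s, (ε k : ℤ) • z k‖ ≤ C * ‖∑ k ∈ s, z k‖

/-- Local unconditional structure: the inclusions of the finite-dimensional subspaces factor, with
a uniform bound, through Banach spaces `F` with a 1-unconditional (finite or infinite) basis. -/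
def HasLocalUnconditionalStructure (𝕜 : Type v) (X : Type u) [RCLike 𝕜] [NormedAddCommGroup X]
    [NormedSpace 𝕜 X] : Prop :=
  ∃ C : ℝ, 1 ≤ C ∧ ∀ X₀ : Submodule 𝕜 X, FiniteDimensional 𝕜 X₀ →
    ∃ (F : Type u) (_ : NormedAddCommGroup F) (_ : NormedSpace 𝕜 F) (_ : CompleteSpace F)
      (β : Type) (_ : Countable β) (f : UnconditionalSchauderBasis β 𝕜 F)
      (u₀ : X₀ →L[𝕜] F) (w₀ : F →L[𝕜] X),
      IsUnconditionalWith 𝕜 1 (fun i => f i) ∧ (∀ x : X₀, w₀ (u₀ x) = (x : X)) ∧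
        ‖u₀‖ * ‖w₀‖ ≤ C

end Unconditionality

/-- `X` has (Rademacher) cotype `r`; the average is taken over all `2 ^ n` choices of signs. -/
def HasCotype (X : Type u) [NormedAddCommGroup X] (r : ℝ) : Prop :=
  ∃ C : ℝ, ∀ (n : ℕ) (x : Fin n → X),
    (∑ i, ‖x i‖ ^ r) ^ (1 / r) ≤
      C * ((∑ ε : Fin n → ℤˣ, ‖∑ i, (ε i : ℤ) • x i‖) / 2 ^ n)

section ComparisonWithLp

/-- The `l_p` norm of the coefficients `t i`, `i ∈ s`, that is, the norm in `l_p` of the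
combination `∑ i ∈ s, t i • δ i` of unit vectors. -/
noncomputable def lpNormOn {𝕜 : Type v} [RCLike 𝕜] (p : ℝ) (s : Finset ℕ) (t : ℕ → 𝕜) : ℝ :=
  (∑ i ∈ s, ‖t i‖ ^ p) ^ (1 / p)

variable (𝕜 : Type v) {X : Type u} [RCLike 𝕜] [NormedAddCommGroup X] [NormedSpace 𝕜 X]

/-- The sequence `x` dominates the unit vector basis of `l_p`. -/
def DominatesLp (p : ℝ) (x : ℕ → X) : Prop :=
  ∃ C : ℝ, ∀ (s : Finset ℕ) (t : ℕ → 𝕜), lpNormOn p s t ≤ C * ‖∑ i ∈ s, t i • x i‖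

/-- The sequence `x` is dominated by the unit vector basis of `l_p`. -/
def IsDominatedByLp (p : ℝ) (x : ℕ → X) : Prop :=
  ∃ C : ℝ, ∀ (s : Finset ℕ) (t : ℕ → 𝕜), ‖∑ i ∈ s, t i • x i‖ ≤ C * lpNormOn p s t

/-- The sequence `x` is equivalent to the unit vector basis of `l_p`. -/
def IsEquivalentToLp (p : ℝ) (x : ℕ → X) : Prop :=
  DominatesLp 𝕜 p x ∧ IsDominatedByLp 𝕜 p x

/-- The finite family `x i`, `i ∈ B`, is `C`-equivalent to the unit vector basis of `l_p^n`,
`n = B.card`. -/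
def IsEquivalentToLpOn (C p : ℝ) (B : Finset ℕ) (x : ℕ → X) : Prop :=
  ∀ t : ℕ → 𝕜, C⁻¹ * lpNormOn p B t ≤ ‖∑ i ∈ B, t i • x i‖ ∧
    ‖∑ i ∈ B, t i • x i‖ ≤ C * lpNormOn p B t

/-- `l_p` is crudely finitely sequence representable in `x`. -/
def IsCrudelyFinitelySequenceRepresentable (p : ℝ) (x : ℕ → X) : Prop :=
  ∃ C : ℝ, 1 ≤ C ∧ ∀ n : ℕ, ∃ B : Finset ℕ, B.card = n ∧ IsEquivalentToLpOn 𝕜 C p B x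

end ComparisonWithLp

/-! The subspace `Y` is a `blockSpace`. Choose disjoint triples of basis vectors with positive
weights and keep, on each triple, only the plane where the normalized coordinates add up to zero.
The planes form an unconditional decomposition because signs on planes are signs on basis vectors.
The task is to choose triples and weights so that `Y` has no local unconditional structure.

Suppose the inclusion of finitely many planes factors through a space with a 1-unconditional basis
`f`. On each plane the identity, whose trace is 2, is a sum of rank one operators indexed by `f`. By
`norm_trace_rankOne_le` one of the three coordinates must account for a fixed part of the trace; let
this coordinate be the colour of the triple. Over triples of colour `i`, the Grothendieck–Krivine
inequality `norm_squareFunction_le` and Khinchin's inequality bound the layer `i` by a constant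
times the other two layers (`exists_coloring_of_factorization`), since the vectors `kerVec i` do not
see the coordinate `i`. It therefore suffices to find, for every `R`, a finite set of weighted
triples for which each 3-colouring has a monochromatic set violating this bound with constant `R`
(`HasSeparatingConfiguration`).

Such triples are arranged in rows (`hasSeparatingConfiguration_of_rows`). One entry `D` of the
triples runs through different blocks, the second entry `B` through one block per row, the third
entry `g` through one last block; inside a block the basis behaves like `l_p`. For any colouring, a
first colour occurs somewhere, or a whole row has the second colour, or a branch choosing one triple
per row has the third. König's lemma bounds the length of the branches needed. Widely separated
weights settle the first case.

If the basis (or a subsequence) is dominated by `l_p`, no disjoint sequence of single vectors or of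
pair sums dominates `l_p`, for it would be equivalent to `l_p`. Then `D` is small against `l_p` on
suitable row vectors, and `D + B` is small on suitable branch vectors, while the layer to be
separated is of `l_p` size. If no subsequence is dominated by `l_p`, then `D` can be made large on
rows, and on branches `B` must become large before `D` does. A Nash-Williams type theorem
(`isRamseyBeyond_of_locally_determined`) secures this: were it to fail on all transversals of a
large set, a shift by one term would give a contradiction (`exists_large_oddTermsExceedFirst`). -/

/-! ### Lattice-type estimates for 1-unconditional families. -/

section Lattice

variable {𝕜 : Type v} [RCLike 𝕜] {X : Type u} [NormedAddCommGroup X] [NormedSpace 𝕜 X]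
  {β : Type*} {x : β → X}

/-- In a `1`-unconditional family, multiplying the coefficients by real numbers of modulus at most
one does not increase the norm. -/
theorem IsUnconditionalWith.norm_sum_real_mul_le (h : IsUnconditionalWith 𝕜 1 x) (s : Finset β)
    (b : β → 𝕜) (ρ : β → ℝ) (hρ : ∀ i, |ρ i| ≤ 1) :
    ‖∑ i ∈ s, ((ρ i : 𝕜) * b i) • x i‖ ≤ ‖∑ i ∈ s, b i • x i‖ := by
  classical
  have key : ∀ (T : Finset β), T ⊆ s → ∀ b : β → 𝕜,
      ‖∑ i ∈ s, (((if i ∈ T then ρ i else 1 : ℝ) : 𝕜) * b i) • x i‖ ≤ ‖∑ i ∈ s, b i • x i‖ := by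
    intro T
    induction T using Finset.induction_on with
    | empty => intro _ b; simp
    | insert j T hj ih =>
      intro hT b
      have hTs : T ⊆ s := fun i hi => hT (Finset.mem_insert_of_mem hi)
      let b' : β → 𝕜 := fun i => if i = j then - b i else b i
      have h1 := ih hTs b
      have h2 := ih hTs b'
      have h3 : ‖∑ i ∈ s, b' i • x i‖ ≤ ‖∑ i ∈ s, b i • x i‖ := by
        have := h s b (fun i => if i = j then -1 else 1)
        rw [one_mul] at this
        convert this using 3 with i hi
        by_cases hij : i = j <;> simp [b', hij]
      have hρj := abs_le.1 (hρ j)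
      -- The multiplier `ρ j` is a convex combination of `1` and `-1`, so one coordinate at a time
      -- can be treated by averaging over a sign change.
      have hsum : ∑ i ∈ s, (((if i ∈ insert j T then ρ i else 1 : ℝ) : 𝕜) * b i) • x i
          = (((1 + ρ j) / 2 : ℝ) : 𝕜) •
              ∑ i ∈ s, (((if i ∈ T then ρ i else 1 : ℝ) : 𝕜) * b i) • x i
            + (((1 - ρ j) / 2 : ℝ) : 𝕜) •
              ∑ i ∈ s, (((if i ∈ T then ρ i else 1 : ℝ) : 𝕜) * b' i) • x i := by
        rw [Finset.smul_sum, Finset.smul_sum, ← Finset.sum_add_distrib]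
        refine Finset.sum_congr rfl fun i _ => ?_
        rw [smul_smul, smul_smul, ← add_smul]
        congr 1
        by_cases hij : i = j
        · subst hij
          simp only [Finset.mem_insert_self, if_true, hj, if_false, b']
          push_cast
          ring
        · simp only [Finset.mem_insert, hij, false_or, b', if_false]
          push_cast
          ring
      rw [hsum]
      refine (norm_add_le _ _).trans ?_
      rw [norm_smul, norm_smul, RCLike.norm_ofReal, RCLike.norm_ofReal,
        abs_of_nonneg (by linarith), abs_of_nonneg (by linarith)]
      nlinarith [h2.trans h3]
  have := key s subset_rfl b
  convert this using 3 with i hi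
  simp [hi]

/-- In a `1`-unconditional family, partial sums have smaller norm. -/
theorem IsUnconditionalWith.norm_sum_subset_le (h : IsUnconditionalWith 𝕜 1 x) {s t : Finset β}
    (hst : s ⊆ t) (b : β → 𝕜) : ‖∑ i ∈ s, b i • x i‖ ≤ ‖∑ i ∈ t, b i • x i‖ := by
  classical
  have := h.norm_sum_real_mul_le t b (fun i => if i ∈ s then 1 else 0)
    (fun i => by split_ifs <;> simp)
  refine le_trans (le_of_eq ?_) this
  congr 1
  rw [← Finset.sum_subset hst]
  · exact Finset.sum_congr rfl fun i hi => by simp [hi]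
  · intro i _ hi
    simp [hi]

/-- In a `1`-unconditional family, the norm is monotone in the moduli of the coefficients, up to
the factor `2`. -/
theorem IsUnconditionalWith.norm_sum_le_two_mul (h : IsUnconditionalWith 𝕜 1 x) (s : Finset β)
    (a b : β → 𝕜) (hab : ∀ i ∈ s, ‖a i‖ ≤ ‖b i‖) :
    ‖∑ i ∈ s, a i • x i‖ ≤ 2 * ‖∑ i ∈ s, b i • x i‖ := by
  classical
  -- The quotient has modulus at most one; its real and imaginary parts are real multipliers, each
  -- costing one copy of the norm. Where `b i = 0` the hypothesis forces `a i = 0`.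
  let c : β → 𝕜 := fun i => if i ∈ s then a i / b i else 0
  have hc : ∀ i, ‖c i‖ ≤ 1 := by
    intro i
    by_cases hi : i ∈ s
    · simp only [c, hi, if_true, norm_div]
      exact div_le_one_of_le₀ (hab i hi) (norm_nonneg _)
    · simp [c, hi]
  have hre := h.norm_sum_real_mul_le s b (fun i => RCLike.re (c i))
    (fun i => (RCLike.abs_re_le_norm _).trans (hc i))
  have him := h.norm_sum_real_mul_le s b (fun i => RCLike.im (c i))
    (fun i => (RCLike.abs_im_le_norm _).trans (hc i))
  have hsum : ∑ i ∈ s, a i • x i = ∑ i ∈ s, ((RCLike.re (c i) : 𝕜) * b i) • x i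
      + (RCLike.I : 𝕜) • ∑ i ∈ s, ((RCLike.im (c i) : 𝕜) * b i) • x i := by
    rw [Finset.smul_sum, ← Finset.sum_add_distrib]
    refine Finset.sum_congr rfl fun i hi => ?_
    rw [smul_smul, ← add_smul]
    congr 1
    have h1 : a i = c i * b i := by
      by_cases hb : b i = 0
      · have := hab i hi
        rw [hb, norm_zero] at this
        rw [hb, mul_zero]
        exact norm_le_zero_iff.1 this
      · simp only [c, hi, if_true]
        field_simp
    conv_lhs => rw [h1, ← RCLike.re_add_im (c i)]
    ring
  have hI : ‖(RCLike.I : 𝕜)‖ ≤ 1 := by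
    rcases (RCLike.I_eq_zero_or_im_I_eq_one : (RCLike.I : 𝕜) = 0 ∨ _) with h0 | h0
    · rw [h0]; simp
    · have : (RCLike.I : 𝕜) ≠ 0 := by
        intro h1; rw [h1] at h0; simp at h0
      exact (RCLike.norm_I_of_ne_zero this).le
  rw [hsum]
  refine (norm_add_le _ _).trans ?_
  rw [norm_smul]
  have := mul_le_mul hI him (norm_nonneg _) zero_le_one
  linarith

end Lattice

/-! ### Moments of finite random sign sums. -/

section Rademacher

variable {𝕜 : Type v} [RCLike 𝕜]

theorem sq_norm_add_add_sq_norm_sub (a b : 𝕜) :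
    ‖a + b‖ ^ 2 + ‖a - b‖ ^ 2 = 2 * (‖a‖ ^ 2 + ‖b‖ ^ 2) := by
  have := parallelogram_law_with_norm 𝕜 a b
  nlinarith

theorem norm_add_pow_four_add_norm_sub_pow_four_le (a b : 𝕜) :
    ‖a + b‖ ^ 4 + ‖a - b‖ ^ 4 ≤ 2 * (‖a‖ ^ 4 + 6 * ‖a‖ ^ 2 * ‖b‖ ^ 2 + ‖b‖ ^ 4) := by
  have h1 := @norm_add_sq 𝕜 𝕜 _ _ _ a b
  have h2 := @norm_sub_sq 𝕜 𝕜 _ _ _ a b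
  have h3 := abs_le.1 ((RCLike.abs_re_le_norm (inner 𝕜 a b)).trans (norm_inner_le_norm a b))
  have h4 : (RCLike.re (inner 𝕜 a b)) ^ 2 ≤ ‖a‖ ^ 2 * ‖b‖ ^ 2 := by
    rw [← mul_pow]; exact sq_le_sq' h3.1 h3.2
  have e1 : ‖a + b‖ ^ 4 = (‖a + b‖ ^ 2) ^ 2 := by ring
  have e2 : ‖a - b‖ ^ 4 = (‖a - b‖ ^ 2) ^ 2 := by ring
  rw [e1, e2, h1, h2]
  nlinarith

/-- A finite probability space with independent signs: second and fourth moments, and the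
comparison of the first two moments, of their linear combinations. -/
theorem exists_rademacher {ι : Type*} (s : Finset ι) :
    ∃ (Ω : Type) (_ : Fintype Ω) (_ : Nonempty Ω) (r : Ω → ι → ℤˣ), ∀ a : ι → 𝕜,
      ∑ ω, ‖∑ k ∈ s, (r ω k : ℤ) • a k‖ ^ 2 = Fintype.card Ω * ∑ k ∈ s, ‖a k‖ ^ 2 ∧
      ∑ ω, ‖∑ k ∈ s, (r ω k : ℤ) • a k‖ ^ 4 ≤
        3 * Fintype.card Ω * (∑ k ∈ s, ‖a k‖ ^ 2) ^ 2 := by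
  classical
  induction s using Finset.induction_on with
  | empty => exact ⟨Unit, inferInstance, inferInstance, fun _ _ => 1, fun a => by simp⟩
  | insert j s hj ih =>
    obtain ⟨Ω, _, _, r, hr⟩ := ih
    refine ⟨Ω × Bool, inferInstance, inferInstance,
      fun ω i => if i = j then (if ω.2 then 1 else -1) else r ω.1 i, fun a => ?_⟩
    obtain ⟨h2, h4⟩ := hr a
    have hS : ∀ ω : Ω × Bool, ∑ k ∈ insert j s,
        ((if k = j then (if ω.2 then 1 else -1) else r ω.1 k : ℤˣ) : ℤ) • a k
        = (if ω.2 then (∑ k ∈ s, (r ω.1 k : ℤ) • a k) + a j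
            else (∑ k ∈ s, (r ω.1 k : ℤ) • a k) - a j) := by
      intro ω
      rw [Finset.sum_insert hj]
      have : ∑ k ∈ s, ((if k = j then (if ω.2 then 1 else -1) else r ω.1 k : ℤˣ) : ℤ) • a k
          = ∑ k ∈ s, (r ω.1 k : ℤ) • a k := by
        refine Finset.sum_congr rfl fun k hk => ?_
        rw [if_neg]
        rintro rfl
        exact hj hk
      rw [this]
      by_cases hω : ω.2 <;> simp [hω] <;> abel
    simp only [hS, Fintype.sum_prod_type, Fintype.sum_bool, if_true, Bool.false_eq_true, if_false,
      Fintype.card_prod, Fintype.card_bool, Finset.sum_insert hj]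
    constructor
    · simp only [sq_norm_add_add_sq_norm_sub]
      rw [← Finset.mul_sum, Finset.sum_add_distrib, h2, Finset.sum_const, Finset.card_univ,
        nsmul_eq_mul]
      push_cast
      ring
    -- With `Q` the sum of squares over `s`, the claim closes because `3Q² + 6Q‖a j‖² + ‖a j‖⁴ ≤ 3(Q
    -- + ‖a j‖²)²`.
    · refine (Finset.sum_le_sum fun ω _ =>
        norm_add_pow_four_add_norm_sub_pow_four_le _ _).trans ?_
      rw [← Finset.mul_sum, Finset.sum_add_distrib, Finset.sum_add_distrib, ← Finset.sum_mul,
        ← Finset.mul_sum, h2, Finset.sum_const, Finset.card_univ, nsmul_eq_mul]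
      push_cast
      have hc : (0 : ℝ) ≤ Fintype.card Ω := by positivity
      have : (0 : ℝ) ≤ Fintype.card Ω * ‖a j‖ ^ 4 := by positivity
      nlinarith

/-- The `L₂` norm is at most twice the `L₁` norm when the fourth moment is controlled. -/
theorem card_mul_sqrt_le_two_mul_sum {Ω : Type*} [Fintype Ω] (S : Ω → ℝ) (q : ℝ)
    (hS : ∀ ω, 0 ≤ S ω) (hq : 0 ≤ q) (h2 : ∑ ω, S ω ^ 2 = Fintype.card Ω * q)
    (h4 : ∑ ω, S ω ^ 4 ≤ 3 * Fintype.card Ω * q ^ 2) :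
    Fintype.card Ω * √q ≤ 2 * ∑ ω, S ω := by
  rcases hq.eq_or_lt with rfl | hq
  · simp only [Real.sqrt_zero, mul_zero]
    exact mul_nonneg zero_le_two (Finset.sum_nonneg fun ω _ => hS ω)
  set σ := √q with hσ
  have hσ0 : 0 < σ := Real.sqrt_pos.2 hq
  have hq2 : q = σ ^ 2 := (Real.sq_sqrt hq.le).symm
  -- This is `S(2S - 3σ)²(S + 3σ) ≥ 0` expanded. Summing it against the moment bounds gives `15 ≤
  -- 27` times the normalized first moment, and `27/15 ≤ 2`.
  have hpt : ∀ ω, 27 * σ ^ 2 * S ω ^ 2 - 4 * S ω ^ 4 ≤ 27 * σ ^ 3 * S ω := by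
    intro ω
    have := mul_nonneg (hS ω) (mul_nonneg (sq_nonneg (2 * S ω - 3 * σ))
      (by have := hS ω; positivity : 0 ≤ S ω + 3 * σ))
    nlinarith
  have hsum := Finset.sum_le_sum (s := Finset.univ) fun ω _ => hpt ω
  rw [Finset.sum_sub_distrib, ← Finset.mul_sum, ← Finset.mul_sum, ← Finset.mul_sum, h2] at hsum
  have h4' : ∑ ω, S ω ^ 4 ≤ 3 * Fintype.card Ω * σ ^ 4 := by rw [hq2] at h4; convert h4 using 1; ring
  rw [hq2] at hsum
  have hfin : 15 * (Fintype.card Ω : ℝ) * σ ^ 4 ≤ 27 * σ ^ 3 * ∑ ω, S ω := by nlinarith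
  have h5 : σ ^ 3 * (15 * (Fintype.card Ω : ℝ) * σ) ≤ σ ^ 3 * (27 * ∑ ω, S ω) := by
    calc _ = 15 * (Fintype.card Ω : ℝ) * σ ^ 4 := by ring
      _ ≤ _ := hfin
      _ = _ := by ring
  have h6 := le_of_mul_le_mul_left h5 (by positivity)
  have h7 : 0 ≤ ∑ ω, S ω := Finset.sum_nonneg fun ω _ => hS ω
  linarith

end Rademacher

/-! ### The Grothendieck–Krivine inequality for square functions. -/

section SquareFunction

variable {𝕜 : Type v} [RCLike 𝕜] {F : Type*} [NormedAddCommGroup F] [NormedSpace 𝕜 F]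
  {X : Type*} [NormedAddCommGroup X] [NormedSpace 𝕜 X] {β Λ : Type*}

/-- The `k`-th value of the matrix `v`, restricted to the columns in `s`, on the vector `a`. -/
def matVec (v : Λ → β → 𝕜) (s : Finset β) (l : Λ) (a : β → 𝕜) : 𝕜 := ∑ j ∈ s, v l j * a j

theorem matVec_add (v : Λ → β → 𝕜) (s : Finset β) (l : Λ) (a b : β → 𝕜) :
    matVec v s l (a + b) = matVec v s l a + matVec v s l b := by
  simp [matVec, mul_add, Finset.sum_add_distrib]

theorem matVec_smul (v : Λ → β → 𝕜) (s : Finset β) (l : Λ) (c : 𝕜) (a : β → 𝕜) :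
    matVec v s l (c • a) = c * matVec v s l a := by
  simp only [matVec, Finset.mul_sum, Pi.smul_apply, smul_eq_mul]
  exact Finset.sum_congr rfl fun _ _ => by ring

theorem matVec_sum_zsmul (v : Λ → β → 𝕜) (s : Finset β) (l : Λ) {ι : Type*} (u : Finset ι)
    (r : ι → ℤ) (a : ι → β → 𝕜) :
    matVec v s l (fun j => ∑ k ∈ u, r k • a k j) = ∑ k ∈ u, r k • matVec v s l (a k) := by
  simp only [matVec, Finset.mul_sum, Finset.smul_sum]
  rw [Finset.sum_comm]
  refine Finset.sum_congr rfl fun k _ => Finset.sum_congr rfl fun j _ => ?_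
  rw [mul_smul_comm]

/-- Truncating a random sum of size `h` at the level `16 * h` leaves a small remainder. -/
theorem sum_sq_norm_truncation_le {Ω : Type*} [Fintype Ω] (G : Ω → 𝕜) (h q : ℝ)
    (hh : 0 ≤ h) (hq : 0 ≤ q) (hqh : q ≤ h ^ 2) (h2 : ∑ ω, ‖G ω‖ ^ 2 = Fintype.card Ω * q)
    (h4 : ∑ ω, ‖G ω‖ ^ 4 ≤ 3 * Fintype.card Ω * q ^ 2) :
    64 * ∑ ω, ‖G ω - (if ‖G ω‖ ≤ 16 * h then G ω else 0)‖ ^ 2 ≤ Fintype.card Ω * h ^ 2 := by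
  have hc : (0 : ℝ) ≤ Fintype.card Ω := by positivity
  rcases hh.eq_or_lt with rfl | hh
  · have hq0 : q = 0 := by nlinarith
    rw [hq0, mul_zero] at h2
    have hz := (Finset.sum_eq_zero_iff_of_nonneg (fun ω _ => sq_nonneg ‖G ω‖)).1 h2
    have : ∀ ω, G ω = 0 := fun ω => by simpa using hz ω (Finset.mem_univ ω)
    simp [this]
  · have hpt : ∀ ω, (16 * h) ^ 2 * ‖G ω - (if ‖G ω‖ ≤ 16 * h then G ω else 0)‖ ^ 2
        ≤ ‖G ω‖ ^ 4 := by
      intro ω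
      split_ifs with hω
      · simp
      · rw [sub_zero]
        have h1 : (16 * h) ^ 2 ≤ ‖G ω‖ ^ 2 := by
          have := (not_le.1 hω).le
          gcongr
        calc _ ≤ ‖G ω‖ ^ 2 * ‖G ω‖ ^ 2 := by gcongr
          _ = _ := by ring
    have hsum := Finset.sum_le_sum (s := Finset.univ) fun ω _ => hpt ω
    rw [← Finset.mul_sum] at hsum
    set D := ∑ ω, ‖G ω - (if ‖G ω‖ ≤ 16 * h then G ω else 0)‖ ^ 2
    have hq2 : q ^ 2 ≤ (h ^ 2) ^ 2 := by gcongr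
    have h5 : h ^ 2 * (256 * D) ≤ h ^ 2 * (3 * Fintype.card Ω * h ^ 2) := by
      calc _ = (16 * h) ^ 2 * D := by ring
        _ ≤ 3 * Fintype.card Ω * q ^ 2 := hsum.trans h4
        _ ≤ 3 * Fintype.card Ω * (h ^ 2) ^ 2 := by gcongr
        _ = _ := by ring
    have h6 := le_of_mul_le_mul_left h5 (by positivity)
    have : 0 ≤ (Fintype.card Ω : ℝ) * h ^ 2 := by positivity
    linarith

/-- One step of the self-improvement in the Grothendieck–Krivine inequality: a bound `Γ` for
the square functions of all families dominated by `h` can be improved. -/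
theorem norm_squareFunction_improve {f : β → F} (hf : IsUnconditionalWith 𝕜 1 f) {e : Λ → X}
    (he : IsUnconditionalWith 𝕜 1 e) (s : Finset β) (t : Finset Λ) (v : Λ → β → 𝕜) (A : ℝ)
    (hA : 0 ≤ A)
    (hv : ∀ a : β → 𝕜, ‖∑ l ∈ t, matVec v s l a • e l‖ ≤ A * ‖∑ j ∈ s, a j • f j‖)
    (h : β → ℝ) (hh : ∀ j, 0 ≤ h j) (Γ : ℝ)
    (hΓ : ∀ (ι : Type) (u : Finset ι) (a : ι → β → 𝕜),
      (∀ j ∈ s, ∑ k ∈ u, ‖a k j‖ ^ 2 ≤ h j ^ 2) →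
      ‖∑ l ∈ t, ((√(∑ k ∈ u, ‖matVec v s l (a k)‖ ^ 2) : ℝ) : 𝕜) • e l‖ ≤ Γ)
    (ι : Type) (u : Finset ι) (a : ι → β → 𝕜) (ha : ∀ j ∈ s, ∑ k ∈ u, ‖a k j‖ ^ 2 ≤ h j ^ 2) :
    ‖∑ l ∈ t, ((√(∑ k ∈ u, ‖matVec v s l (a k)‖ ^ 2) : ℝ) : 𝕜) • e l‖ ≤
      256 * (A * ‖∑ j ∈ s, (h j : 𝕜) • f j‖) + Γ / 2 := by
  classical
  obtain ⟨Ω, _, _, r, hr⟩ := exists_rademacher (𝕜 := 𝕜) u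
  set c : ℝ := (Fintype.card Ω : ℝ) with hcdef
  have hc : 0 < c := by rw [hcdef]; exact_mod_cast Fintype.card_pos
  let G : Ω → β → 𝕜 := fun ω j => ∑ k ∈ u, (r ω k : ℤ) • a k j
  let G₁ : Ω → β → 𝕜 := fun ω j => if ‖G ω j‖ ≤ 16 * h j then G ω j else 0
  let G₂ : Ω → β → 𝕜 := fun ω j => G ω j - G₁ ω j
  -- The rescaled remainder is again a family with square function at most `h`, indexed by `Ω`, so
  -- the bound `Γ` applies to it. The factor `8` is the square root of the `64` in
  -- `sum_sq_norm_truncation_le`.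
  let b : Ω → β → 𝕜 := fun ω => ((8 / √c : ℝ) : 𝕜) • G₂ ω
  have hb : ∀ j ∈ s, ∑ ω, ‖b ω j‖ ^ 2 ≤ h j ^ 2 := by
    intro j hj
    have h1 := sum_sq_norm_truncation_le (fun ω => G ω j) (h j) (∑ k ∈ u, ‖a k j‖ ^ 2) (hh j)
      (Finset.sum_nonneg fun _ _ => sq_nonneg _) (ha j hj) (hr fun k => a k j).1
      (hr fun k => a k j).2
    have h2 : ∑ ω, ‖b ω j‖ ^ 2 = 64 / c * ∑ ω, ‖G₂ ω j‖ ^ 2 := by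
      rw [Finset.mul_sum]
      refine Finset.sum_congr rfl fun ω _ => ?_
      simp only [b, Pi.smul_apply, smul_eq_mul, norm_mul, RCLike.norm_ofReal, mul_pow, sq_abs,
        div_pow, Real.sq_sqrt hc.le]
      norm_num
    rw [h2, div_mul_eq_mul_div, div_le_iff₀ hc, mul_comm (h j ^ 2)]
    exact h1
  have hbΓ := hΓ Ω Finset.univ b hb
  -- Pointwise, the square function is at most twice the mean of the random sums. The truncated part
  -- is kept as it is; for the remainder Cauchy–Schwarz returns to a square function, and the
  -- scaling by `8` leaves the coefficient `2/8`.
  have hpt : ∀ l, √(∑ k ∈ u, ‖matVec v s l (a k)‖ ^ 2) ≤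
      2 / c * ∑ ω, ‖matVec v s l (G₁ ω)‖ + 1 / 4 * √(∑ ω, ‖matVec v s l (b ω)‖ ^ 2) := by
    intro l
    have hVG : ∀ ω, matVec v s l (G ω) = ∑ k ∈ u, (r ω k : ℤ) • matVec v s l (a k) :=
      fun ω => matVec_sum_zsmul v s l u _ a
    have hK := card_mul_sqrt_le_two_mul_sum (fun ω => ‖matVec v s l (G ω)‖)
      (∑ k ∈ u, ‖matVec v s l (a k)‖ ^ 2) (fun _ => norm_nonneg _)
      (Finset.sum_nonneg fun _ _ => sq_nonneg _)
      (by simp only [hVG]; exact (hr _).1) (by simp only [hVG]; exact (hr _).2)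
    have hsplit : ∑ ω, ‖matVec v s l (G ω)‖ ≤
        ∑ ω, ‖matVec v s l (G₁ ω)‖ + ∑ ω, ‖matVec v s l (G₂ ω)‖ := by
      rw [← Finset.sum_add_distrib]
      refine Finset.sum_le_sum fun ω _ => ?_
      have : G ω = G₁ ω + G₂ ω := by ext j; simp [G₂]
      rw [this, matVec_add]
      exact norm_add_le _ _
    have hCS : ∑ ω, ‖matVec v s l (G₂ ω)‖ ≤ √c * √(∑ ω, ‖matVec v s l (G₂ ω)‖ ^ 2) := by
      rw [← Real.sqrt_mul hc.le]
      refine Real.le_sqrt_of_sq_le ?_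
      have := sq_sum_le_card_mul_sum_sq (s := (Finset.univ : Finset Ω))
        (f := fun ω => ‖matVec v s l (G₂ ω)‖)
      simpa [hcdef] using this
    have hb2 : √(∑ ω, ‖matVec v s l (b ω)‖ ^ 2) =
        8 / √c * √(∑ ω, ‖matVec v s l (G₂ ω)‖ ^ 2) := by
      have : ∑ ω, ‖matVec v s l (b ω)‖ ^ 2 = (8 / √c) ^ 2 * ∑ ω, ‖matVec v s l (G₂ ω)‖ ^ 2 := by
        rw [Finset.mul_sum]
        refine Finset.sum_congr rfl fun ω _ => ?_
        simp only [b, matVec_smul, norm_mul, RCLike.norm_ofReal, mul_pow, sq_abs]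
      rw [this, Real.sqrt_mul (sq_nonneg _), Real.sqrt_sq (by positivity)]
    have hcs : √c * √c = c := Real.mul_self_sqrt hc.le
    have hsc : 0 < √c := Real.sqrt_pos.2 hc
    rw [hb2]
    rw [← hcdef] at hK
    set q := √(∑ ω, ‖matVec v s l (G₂ ω)‖ ^ 2)
    have e1 : c * (2 / c * ∑ ω, ‖matVec v s l (G₁ ω)‖ + 1 / 4 * (8 / √c * q)) =
        2 * ∑ ω, ‖matVec v s l (G₁ ω)‖ + 2 * (√c * q) := by
      have : c / √c = √c := by rw [div_eq_iff hsc.ne', hcs]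
      field_simp
      linear_combination (-8 * q) * hcs
    refine le_of_mul_le_mul_left ?_ hc
    rw [e1]
    linarith
  -- For each fixed choice of signs the truncation is dominated by `16 h`, so the operator bound
  -- applies directly; the two comparisons of moduli give `2 * 2 * 16 = 64`.
  have hG₁ : ∀ ω, ‖∑ l ∈ t, ((‖matVec v s l (G₁ ω)‖ : ℝ) : 𝕜) • e l‖ ≤
      64 * (A * ‖∑ j ∈ s, (h j : 𝕜) • f j‖) := by
    intro ω
    have h1 := he.norm_sum_le_two_mul t (fun l => ((‖matVec v s l (G₁ ω)‖ : ℝ) : 𝕜))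
      (fun l => matVec v s l (G₁ ω)) (fun l _ => by simp)
    have h2 := hf.norm_sum_le_two_mul s (G₁ ω) (fun j => ((16 * h j : ℝ) : 𝕜)) (fun j _ => by
      simp only [G₁]
      rw [RCLike.norm_ofReal, abs_of_nonneg (mul_nonneg (by norm_num) (hh j))]
      split_ifs with hj
      · exact hj
      · simpa using hh j)
    have h3 : ∑ j ∈ s, ((16 * h j : ℝ) : 𝕜) • f j = (16 : 𝕜) • ∑ j ∈ s, (h j : 𝕜) • f j := by
      rw [Finset.smul_sum]
      refine Finset.sum_congr rfl fun j _ => ?_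
      rw [smul_smul]; push_cast; rfl
    have h16 : ‖(16 : 𝕜)‖ = 16 := by norm_num
    rw [h3, norm_smul, h16] at h2
    have h4 := (hv (G₁ ω)).trans (mul_le_mul_of_nonneg_left h2 hA)
    linarith
  set B : Λ → ℝ := fun l =>
    2 / c * ∑ ω, ‖matVec v s l (G₁ ω)‖ + 1 / 4 * √(∑ ω, ‖matVec v s l (b ω)‖ ^ 2)
  have hmono := he.norm_sum_le_two_mul t
    (fun l => ((√(∑ k ∈ u, ‖matVec v s l (a k)‖ ^ 2) : ℝ) : 𝕜)) (fun l => (B l : 𝕜)) (fun l _ => by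
      rw [RCLike.norm_ofReal, RCLike.norm_ofReal, abs_of_nonneg (Real.sqrt_nonneg _)]
      exact (hpt l).trans (le_abs_self _))
  have hBsum : ∑ l ∈ t, (B l : 𝕜) • e l =
      ((2 / c : ℝ) : 𝕜) • ∑ ω, ∑ l ∈ t, ((‖matVec v s l (G₁ ω)‖ : ℝ) : 𝕜) • e l
      + ((1 / 4 : ℝ) : 𝕜) •
        ∑ l ∈ t, ((√(∑ ω, ‖matVec v s l (b ω)‖ ^ 2) : ℝ) : 𝕜) • e l := by
    rw [Finset.sum_comm, Finset.smul_sum, Finset.smul_sum, ← Finset.sum_add_distrib]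
    refine Finset.sum_congr rfl fun l _ => ?_
    rw [← Finset.sum_smul, smul_smul, smul_smul, ← add_smul]
    congr 1
    simp only [B]
    push_cast
    rfl
  have hfirst : ‖∑ ω, ∑ l ∈ t, ((‖matVec v s l (G₁ ω)‖ : ℝ) : 𝕜) • e l‖ ≤
      c * (64 * (A * ‖∑ j ∈ s, (h j : 𝕜) • f j‖)) := by
    refine (norm_sum_le _ _).trans ((Finset.sum_le_sum fun ω _ => hG₁ ω).trans ?_)
    rw [Finset.sum_const, nsmul_eq_mul, Finset.card_univ]
  have hB : ‖∑ l ∈ t, (B l : 𝕜) • e l‖ ≤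
      128 * (A * ‖∑ j ∈ s, (h j : 𝕜) • f j‖) + Γ / 4 := by
    rw [hBsum]
    refine (norm_add_le _ _).trans ?_
    rw [norm_smul, norm_smul, RCLike.norm_ofReal, RCLike.norm_ofReal,
      abs_of_pos (by positivity : 0 < 2 / c), abs_of_pos (by norm_num : (0 : ℝ) < 1 / 4)]
    have h1 := mul_le_mul_of_nonneg_left hfirst (by positivity : 0 ≤ 2 / c)
    have h2 : 2 / c * (c * (64 * (A * ‖∑ j ∈ s, (h j : 𝕜) • f j‖))) =
        128 * (A * ‖∑ j ∈ s, (h j : 𝕜) • f j‖) := by field_simp; ring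
    linarith
  linarith

/-- The Grothendieck–Krivine inequality for operators between spaces with `1`-unconditional
bases, in terms of square functions. -/
theorem norm_squareFunction_le {f : β → F} (hf : IsUnconditionalWith 𝕜 1 f) {e : Λ → X}
    (he : IsUnconditionalWith 𝕜 1 e) (s : Finset β) (t : Finset Λ) (v : Λ → β → 𝕜) (A : ℝ)
    (hA : 0 ≤ A)
    (hv : ∀ a : β → 𝕜, ‖∑ l ∈ t, matVec v s l a • e l‖ ≤ A * ‖∑ j ∈ s, a j • f j‖)
    (h : β → ℝ) (hh : ∀ j, 0 ≤ h j)
    (ι : Type) (u : Finset ι) (a : ι → β → 𝕜) (ha : ∀ j ∈ s, ∑ k ∈ u, ‖a k j‖ ^ 2 ≤ h j ^ 2) :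
    ‖∑ l ∈ t, ((√(∑ k ∈ u, ‖matVec v s l (a k)‖ ^ 2) : ℝ) : 𝕜) • e l‖ ≤
      512 * (A * ‖∑ j ∈ s, (h j : 𝕜) • f j‖) := by
  -- The supremum runs over all finite index sets because the improvement step replaces the index
  -- set by the probability space. It must be finite before `Γ ≤ 256(⋯) + Γ / 2` can be solved for
  -- `Γ`; a crude Cauchy–Schwarz bound depending on `s` and `t` provides that.
  let S : Set ℝ := {y | ∃ (ι : Type) (u : Finset ι) (a : ι → β → 𝕜),
    (∀ j ∈ s, ∑ k ∈ u, ‖a k j‖ ^ 2 ≤ h j ^ 2) ∧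
    y = ‖∑ l ∈ t, ((√(∑ k ∈ u, ‖matVec v s l (a k)‖ ^ 2) : ℝ) : 𝕜) • e l‖}
  have hbdd : BddAbove S := by
    refine ⟨∑ l ∈ t, √((∑ j ∈ s, ‖v l j‖ ^ 2) * ∑ j ∈ s, h j ^ 2) * ‖e l‖, ?_⟩
    rintro y ⟨ι, u, a, ha, rfl⟩
    refine (norm_sum_le _ _).trans (Finset.sum_le_sum fun l _ => ?_)
    rw [norm_smul, RCLike.norm_ofReal, abs_of_nonneg (Real.sqrt_nonneg _)]
    refine mul_le_mul_of_nonneg_right (Real.sqrt_le_sqrt ?_) (norm_nonneg _)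
    calc ∑ k ∈ u, ‖matVec v s l (a k)‖ ^ 2
        ≤ ∑ k ∈ u, (∑ j ∈ s, ‖v l j‖ ^ 2) * ∑ j ∈ s, ‖a k j‖ ^ 2 := by
          refine Finset.sum_le_sum fun k _ => ?_
          have h1 : ‖matVec v s l (a k)‖ ≤ ∑ j ∈ s, ‖v l j‖ * ‖a k j‖ := by
            refine (norm_sum_le _ _).trans (le_of_eq ?_)
            simp only [norm_mul]
          refine (pow_le_pow_left₀ (norm_nonneg _) h1 2).trans ?_
          exact Finset.sum_mul_sq_le_sq_mul_sq _ _ _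
      _ = (∑ j ∈ s, ‖v l j‖ ^ 2) * ∑ j ∈ s, ∑ k ∈ u, ‖a k j‖ ^ 2 := by
          rw [← Finset.mul_sum, Finset.sum_comm]
      _ ≤ _ := by
          refine mul_le_mul_of_nonneg_left (Finset.sum_le_sum ha) ?_
          exact Finset.sum_nonneg fun _ _ => sq_nonneg _
  have hne : S.Nonempty := ⟨_, ι, u, a, ha, rfl⟩
  have himp : sSup S ≤ 256 * (A * ‖∑ j ∈ s, (h j : 𝕜) • f j‖) + sSup S / 2 := by
    refine csSup_le hne ?_
    rintro y ⟨ι, u, a, ha, rfl⟩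
    refine norm_squareFunction_improve hf he s t v A hA hv h hh (sSup S) ?_ ι u a ha
    intro ι u a ha
    exact le_csSup hbdd ⟨ι, u, a, ha, rfl⟩
  have := le_csSup hbdd ⟨ι, u, a, ha, rfl⟩
  linarith

end SquareFunction

/-! ### Coordinate projections and reindexing. -/

section BasisProjections

variable {𝕜 : Type v} [RCLike 𝕜] {X : Type u} [NormedAddCommGroup X] [NormedSpace 𝕜 X]
  {β : Type*} {L : SummationFilter β}

/-- The coordinate projections of a `1`-unconditional basis are contractions. -/
theorem IsUnconditionalWith.norm_sum_coord_le [L.LeAtTop] [L.NeBot]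
    (f : GeneralSchauderBasis β 𝕜 X L) (hf : IsUnconditionalWith 𝕜 1 (fun i => f i))
    (s : Finset β) (y : X) : ‖∑ j ∈ s, f.coord j y • f j‖ ≤ ‖y‖ := by
  have h1 : Tendsto (fun A : Finset β => ‖∑ j ∈ A, f.coord j y • f j‖) L.filter (𝓝 ‖y‖) :=
    (f.expansion y).norm
  refine ge_of_tendsto h1 ?_
  have h2 : ∀ᶠ A in L.filter, s ≤ A := L.le_atTop (eventually_ge_atTop s)
  filter_upwards [h2] with A hA
  exact hf.norm_sum_subset_le hA _

theorem IsUnconditionalWith.comp_injective {x : β → X} {C : ℝ} (h : IsUnconditionalWith 𝕜 C x)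
    {γ : Type*} {g : γ → β} (hg : Function.Injective g) :
    IsUnconditionalWith 𝕜 C (fun i => x (g i)) := by
  classical
  intro s t ε
  have := h (s.map ⟨g, hg⟩) (Function.extend g t 0) (Function.extend g ε 1)
  simpa only [Finset.sum_map, Function.Embedding.coeFn_mk, hg.extend_apply] using this

end BasisProjections

/-! ### The subspace built from weighted triples of basis vectors. -/

section BlockSpace

variable {𝕜 : Type v} [RCLike 𝕜] {X : Type u} [NormedAddCommGroup X] [NormedSpace 𝕜 X]

/-- The `i`-th normalized coordinate on the `k`-th block. -/
noncomputable def blockCoord (e : SchauderBasis 𝕜 X) (σ : Fin 3 → ℕ → ℕ) (w : Fin 3 → ℕ → ℝ)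
    (i : Fin 3) (k : ℕ) : StrongDual 𝕜 X :=
  ((w i k : 𝕜)⁻¹) • e.coord (σ i k)

/-- The vector in the `k`-th block with normalized coordinates `a`. -/
noncomputable def blockVec (e : SchauderBasis 𝕜 X) (σ : Fin 3 → ℕ → ℕ) (w : Fin 3 → ℕ → ℝ)
    (k : ℕ) (a : Fin 3 → 𝕜) : X :=
  ∑ i, (a i * (w i k : 𝕜)) • e (σ i k)

/-- The closed subspace of all vectors that live on the blocks and whose normalized coordinates on
each block add up to zero. -/
def blockSpace (e : SchauderBasis 𝕜 X) (σ : Fin 3 → ℕ → ℕ) (w : Fin 3 → ℕ → ℝ) :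
    Submodule 𝕜 X where
  carrier := {y | (∀ l, (∀ i k, σ i k ≠ l) → e.coord l y = 0) ∧
    ∀ k, ∑ i, blockCoord e σ w i k y = 0}
  add_mem' := by
    rintro y z ⟨h1, h2⟩ ⟨h3, h4⟩
    refine ⟨fun l hl => by rw [map_add, h1 l hl, h3 l hl, add_zero], fun k => ?_⟩
    simp only [map_add, Finset.sum_add_distrib, h2, h4, add_zero]
  zero_mem' := by simp
  smul_mem' := by
    rintro c y ⟨h1, h2⟩
    refine ⟨fun l hl => by rw [map_smul, h1 l hl, smul_zero], fun k => ?_⟩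
    simp only [map_smul, ← Finset.smul_sum, h2, smul_zero]

variable {e : SchauderBasis 𝕜 X} {σ : Fin 3 → ℕ → ℕ} {w : Fin 3 → ℕ → ℝ}

theorem coord_basis_apply (e : SchauderBasis 𝕜 X) (l m : ℕ) :
    e.coord l (e m) = if l = m then 1 else 0 := by
  rw [e.ortho]
  by_cases h : l = m
  · subst h; simp
  · simp [h]

theorem blockCoord_basis (hσ : Function.Injective (fun q : Fin 3 × ℕ => σ q.1 q.2)) (i j : Fin 3) (k k' : ℕ) :
    blockCoord e σ w i k (e (σ j k')) = if i = j ∧ k = k' then ((w i k : 𝕜))⁻¹ else 0 := by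
  simp only [blockCoord, smul_apply, coord_basis_apply, smul_eq_mul,
    mul_ite, mul_one, mul_zero]
  have : σ i k = σ j k' ↔ i = j ∧ k = k' := by
    rw [← Prod.mk.injEq]
    exact ⟨fun h => hσ h, fun h => by rw [Prod.mk.injEq] at h; rw [h.1, h.2]⟩
  simp [this]

theorem blockCoord_blockVec (hw : ∀ i k, 0 < w i k)
    (hσ : Function.Injective (fun q : Fin 3 × ℕ => σ q.1 q.2)) (i : Fin 3) (k k' : ℕ)
    (a : Fin 3 → 𝕜) :
    blockCoord e σ w i k (blockVec e σ w k' a) = if k = k' then a i else 0 := by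
  have hne : (w i k : 𝕜) ≠ 0 := RCLike.ofReal_ne_zero.2 (hw i k).ne'
  simp only [blockVec, map_sum, map_smul, blockCoord_basis hσ, smul_eq_mul]
  by_cases h : k = k'
  · subst h
    simp [hne]
  · simp [h]

theorem blockVec_mem (hw : ∀ i k, 0 < w i k)
    (hσ : Function.Injective (fun q : Fin 3 × ℕ => σ q.1 q.2)) (k : ℕ) {a : Fin 3 → 𝕜}
    (ha : ∑ i, a i = 0) : blockVec e σ w k a ∈ blockSpace e σ w := by
  refine ⟨fun l hl => ?_, fun k' => ?_⟩
  · simp only [blockVec, map_sum, map_smul, coord_basis_apply]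
    refine Finset.sum_eq_zero fun i _ => ?_
    rw [if_neg (fun h => hl i k h.symm), smul_zero]
  · simp only [blockCoord_blockVec hw hσ]
    by_cases h : k' = k <;> simp [h, ha]

theorem isClosed_blockSpace : IsClosed (blockSpace e σ w : Set X) := by
  have : (blockSpace e σ w : Set X) =
      (⋂ l, ⋂ (_ : ∀ i k, σ i k ≠ l), {y | e.coord l y = 0}) ∩
      ⋂ k, {y | ∑ i, blockCoord e σ w i k y = 0} := by
    ext y
    simp only [Set.mem_inter_iff, Set.mem_iInter, Set.mem_ofPred_eq]
    rfl
  rw [this]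
  refine IsClosed.inter (isClosed_iInter fun l => isClosed_iInter fun _ => ?_)
    (isClosed_iInter fun k => ?_)
  · exact isClosed_eq (e.coord l).continuous continuous_const
  · exact isClosed_eq (by fun_prop) continuous_const

end BlockSpace

/-! ### Rank one operators on the plane of coordinate sum zero. -/

section KernelVectors

variable {𝕜 : Type v} [RCLike 𝕜]

/-- Vectors with coordinate sum zero; the `i`-th one spans the kernel of the `i`-th coordinate. -/
def kerVec : Fin 3 → Fin 3 → 𝕜 := ![![0, 1, -1], ![-1, 0, 1], ![1, -1, 0]]

theorem sum_kerVec (i : Fin 3) : ∑ j, (kerVec i j : 𝕜) = 0 := by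
  fin_cases i <;> simp [kerVec, Fin.sum_univ_three]

theorem sum_kerVec_swap (j : Fin 3) : ∑ i, (kerVec i j : 𝕜) = 0 := by
  fin_cases j <;> simp [kerVec, Fin.sum_univ_three]

theorem kerVec_self (i : Fin 3) : (kerVec i i : 𝕜) = 0 := by
  fin_cases i <;> simp [kerVec]

theorem norm_kerVec_le (i j : Fin 3) : ‖(kerVec i j : 𝕜)‖ ≤ 1 := by
  fin_cases i <;> fin_cases j <;> simp [kerVec]

/-- The trace of a rank one operator of a plane is controlled by the amounts by which its adjoint
moves three pairwise independent functionals. -/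
theorem norm_trace_rankOne_le (a b : Fin 3 → 𝕜) (ha : ∑ i, a i = 0) (hb : ∑ i, b i = 0) :
    ‖a 0 * b 2 - a 2 * b 0‖ ≤ 2 * ∑ i, ‖a i * b i‖ := by
  rw [Fin.sum_univ_three] at ha hb ⊢
  -- On the plane, the square of the trace is a polynomial in the three products `a i * b i` alone.
  have h1 : (a 0 * b 2 - a 2 * b 0) ^ 2 =
      (a 1 * b 1 - a 0 * b 0 - a 2 * b 2) ^ 2 - 4 * (a 0 * b 0) * (a 2 * b 2) := by
    have e1 : a 1 = -a 0 - a 2 := by linear_combination ha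
    have e2 : b 1 = -b 0 - b 2 := by linear_combination hb
    rw [e1, e2]
    ring
  have h2 : ‖a 0 * b 2 - a 2 * b 0‖ ^ 2 ≤
      (‖a 1 * b 1‖ + ‖a 0 * b 0‖ + ‖a 2 * b 2‖) ^ 2 + 4 * ‖a 0 * b 0‖ * ‖a 2 * b 2‖ := by
    rw [← norm_pow, h1]
    refine (norm_sub_le _ _).trans (add_le_add ?_ ?_)
    · rw [norm_pow]
      refine pow_le_pow_left₀ (norm_nonneg _) ?_ 2
      exact (norm_sub_le _ _).trans (add_le_add_left (norm_sub_le _ _) _)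
    · rw [norm_mul, norm_mul]
      simp
  have n0 := norm_nonneg (a 0 * b 0)
  have n1 := norm_nonneg (a 1 * b 1)
  have n2 := norm_nonneg (a 2 * b 2)
  refine abs_le_of_sq_le_sq' ?_ (by positivity) |>.2
  nlinarith [sq_nonneg (‖a 0 * b 0‖ - ‖a 2 * b 2‖), mul_nonneg n0 n1, mul_nonneg n0 n2,
    mul_nonneg n1 n2]

theorem exists_norm_le_one_mul_eq_norm (q : 𝕜) : ∃ θ : 𝕜, ‖θ‖ ≤ 1 ∧ θ * q = (‖q‖ : 𝕜) := by
  by_cases hq : q = 0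
  · exact ⟨0, by simp, by simp [hq]⟩
  · have hn : (‖q‖ : 𝕜) ≠ 0 := RCLike.ofReal_ne_zero.2 (norm_ne_zero_iff.2 hq)
    refine ⟨(‖q‖ : 𝕜) / q, ?_, by field_simp⟩
    rw [norm_div, RCLike.norm_ofReal, abs_norm, div_self (norm_ne_zero_iff.2 hq)]

end KernelVectors

/-! ### From a factorization through an unconditional basis to a colouring of the triples. -/

section Coloring

variable {𝕜 : Type v} [RCLike 𝕜] {X : Type u} [NormedAddCommGroup X] [NormedSpace 𝕜 X]
  {e : SchauderBasis 𝕜 X} {σ : Fin 3 → ℕ → ℕ} {w : Fin 3 → ℕ → ℝ}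

/-- The norm of the combination of the `j`-th weighted basis vectors of the blocks in `E`. -/
noncomputable def layerNorm (e : SchauderBasis 𝕜 X) (σ : Fin 3 → ℕ → ℕ) (w : Fin 3 → ℕ → ℝ)
    (j : Fin 3) (E : Finset ℕ) (τ : ℕ → 𝕜) : ℝ :=
  ‖∑ k ∈ E, (τ k * (w j k : 𝕜)) • e (σ j k)‖

/-- The layer `i` is absent on the right because `kerVec i` vanishes at `i`; this asymmetry is what
the colouring exploits. -/
theorem norm_sum_blockVec_kerVec_le (i : Fin 3) (E : Finset ℕ) (τ : ℕ → 𝕜) :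
    ‖∑ k ∈ E, τ k • blockVec e σ w k (kerVec i)‖ ≤
      ∑ j ∈ Finset.univ.erase i, layerNorm e σ w j E τ := by
  have h1 : ∑ k ∈ E, τ k • blockVec e σ w k (kerVec i) =
      ∑ j, (kerVec i j : 𝕜) • ∑ k ∈ E, (τ k * (w j k : 𝕜)) • e (σ j k) := by
    simp only [blockVec, Finset.smul_sum]
    rw [Finset.sum_comm]
    refine Finset.sum_congr rfl fun j _ => Finset.sum_congr rfl fun k _ => ?_
    rw [smul_smul, smul_smul]
    congr 1
    ring
  rw [h1, ← Finset.add_sum_erase _ _ (Finset.mem_univ i), kerVec_self, zero_smul, zero_add]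
  refine (norm_sum_le _ _).trans (Finset.sum_le_sum fun j _ => ?_)
  rw [norm_smul]
  exact mul_le_of_le_one_left (norm_nonneg _) (norm_kerVec_le i j)

/-- If the signs in a random sum have modulus one, the square function is controlled by the
random sums (Khinchin's inequality in a space with an unconditional basis). -/
theorem norm_squareFunction_coord_le {F : Type*} [NormedAddCommGroup F] [NormedSpace 𝕜 F]
    {β : Type*} {f : β → F} (hf : IsUnconditionalWith 𝕜 1 f) (J : Finset β) {ι : Type*}
    (E : Finset ι) (b : ι → β → 𝕜) (D : ℝ)
    (hD : ∀ r : ι → ℤˣ, ‖∑ j ∈ J, (∑ k ∈ E, (r k : ℤ) • b k j) • f j‖ ≤ D)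
    (h : β → ℝ) (hh : ∀ j ∈ J, 0 ≤ h j ∧ h j ≤ √(∑ k ∈ E, ‖b k j‖ ^ 2)) :
    ‖∑ j ∈ J, (h j : 𝕜) • f j‖ ≤ 8 * D := by
  obtain ⟨Ω, _, _, r, hr⟩ := exists_rademacher (𝕜 := 𝕜) E
  set c : ℝ := (Fintype.card Ω : ℝ) with hcdef
  have hc : 0 < c := by rw [hcdef]; exact_mod_cast Fintype.card_pos
  let S : Ω → β → 𝕜 := fun ω j => ∑ k ∈ E, (r ω k : ℤ) • b k j
  have hpt : ∀ j ∈ J, h j ≤ 2 / c * ∑ ω, ‖S ω j‖ := by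
    intro j hj
    have hK := card_mul_sqrt_le_two_mul_sum (fun ω => ‖S ω j‖)
      (∑ k ∈ E, ‖b k j‖ ^ 2) (fun _ => norm_nonneg _)
      (Finset.sum_nonneg fun _ _ => sq_nonneg _) (hr fun k => b k j).1 (hr fun k => b k j).2
    rw [← hcdef] at hK
    refine (hh j hj).2.trans ?_
    rw [div_mul_eq_mul_div, le_div_iff₀ hc, mul_comm]
    exact hK
  have h1 := hf.norm_sum_le_two_mul J (fun j => (h j : 𝕜))
    (fun j => ((2 / c * ∑ ω, ‖S ω j‖ : ℝ) : 𝕜)) (fun j hj => by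
      rw [RCLike.norm_ofReal, RCLike.norm_ofReal, abs_of_nonneg (hh j hj).1]
      exact (hpt j hj).trans (le_abs_self _))
  have h2 : ∑ j ∈ J, ((2 / c * ∑ ω, ‖S ω j‖ : ℝ) : 𝕜) • f j =
      ((2 / c : ℝ) : 𝕜) • ∑ ω, ∑ j ∈ J, ((‖S ω j‖ : ℝ) : 𝕜) • f j := by
    rw [Finset.sum_comm, Finset.smul_sum]
    refine Finset.sum_congr rfl fun j _ => ?_
    rw [← Finset.sum_smul, smul_smul]
    congr 1
    push_cast
    rfl
  have h3 : ‖∑ ω, ∑ j ∈ J, ((‖S ω j‖ : ℝ) : 𝕜) • f j‖ ≤ c * (2 * D) := by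
    refine (norm_sum_le _ _).trans ((Finset.sum_le_sum (g := fun _ => 2 * D) fun ω _ => ?_).trans ?_)
    · refine (hf.norm_sum_le_two_mul J _ (S ω) (fun j _ => by simp)).trans ?_
      exact mul_le_mul_of_nonneg_left (hD (r ω)) zero_le_two
    · rw [Finset.sum_const, nsmul_eq_mul, Finset.card_univ]
  rw [h2, norm_smul, RCLike.norm_ofReal, abs_of_pos (by positivity)] at h1
  have h4 := mul_le_mul_of_nonneg_left h3 (by positivity : 0 ≤ 2 / c)
  have h5 : 2 / c * (c * (2 * D)) = 4 * D := by field_simp; ring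
  linarith

/-- The colour of a triple is a coordinate carrying a fixed part of the trace of the identity on its
plane. On one colour the layer is the diagonal of a matrix acting on suitable vectors of `F`. The
diagonal lies below the square function, which passes through `w₀` by the Grothendieck–Krivine
inequality and through `u₀` by Khinchin's inequality. The constant is `12 * 512 * 8 = 49152`. -/
theorem exists_coloring_of_factorization (he : IsUnconditionalWith 𝕜 1 (fun l => e l))
    (hw : ∀ i k, 0 < w i k) (hσ : Function.Injective (fun q : Fin 3 × ℕ => σ q.1 q.2))
    (G : Finset ℕ) {F : Type*} [NormedAddCommGroup F] [NormedSpace 𝕜 F] {β : Type*}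
    (f : UnconditionalSchauderBasis β 𝕜 F) (hf : IsUnconditionalWith 𝕜 1 (fun j => f j))
    (X₀ : Submodule 𝕜 (blockSpace e σ w))
    (hX₀ : ∀ k ∈ G, ∀ i, (⟨blockVec e σ w k (kerVec i), blockVec_mem hw hσ k (sum_kerVec i)⟩ :
      blockSpace e σ w) ∈ X₀)
    (u₀ : X₀ →L[𝕜] F) (w₀ : F →L[𝕜] blockSpace e σ w) (hfac : ∀ x : X₀, w₀ (u₀ x) = x) (C : ℝ)
    (hC : ‖u₀‖ * ‖w₀‖ ≤ C) :
    ∃ c : ℕ → Fin 3, ∀ (i : Fin 3) (E : Finset ℕ), E ⊆ G → (∀ k ∈ E, c k = i) → ∀ τ : ℕ → 𝕜,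
      layerNorm e σ w i E τ ≤
        49152 * C * ∑ j ∈ Finset.univ.erase i, layerNorm e σ w j E τ := by
  classical
  let zz : Fin 3 → ℕ → X₀ := fun i k => if hk : k ∈ G then
    ⟨⟨blockVec e σ w k (kerVec i), blockVec_mem hw hσ k (sum_kerVec i)⟩, hX₀ k hk i⟩ else 0
  have hzz : ∀ i k, k ∈ G → ((zz i k : blockSpace e σ w) : X) = blockVec e σ w k (kerVec i) := by
    intro i k hk
    simp only [zz, hk, dif_pos]
  let V : β → Fin 3 → ℕ → 𝕜 := fun j i k => blockCoord e σ w i k (w₀ (f j) : X)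
  let Ψ : β → Fin 3 → ℕ → 𝕜 := fun j i k => f.coord j (u₀ (zz i k))
  have hV : ∀ j k, ∑ i, V j i k = 0 := fun j k => (w₀ (f j)).2.2 k
  have hΨ : ∀ j k, k ∈ G → ∑ i, Ψ j i k = 0 := by
    intro j k hk
    simp only [Ψ]
    rw [← map_sum, ← map_sum]
    have : ∑ i, zz i k = 0 := by
      apply Subtype.ext
      apply Subtype.ext
      simp only [Submodule.coe_sum, hzz _ k hk, ZeroMemClass.coe_zero, blockVec]
      rw [Finset.sum_comm]
      refine Finset.sum_eq_zero fun l _ => ?_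
      rw [← Finset.sum_smul, ← Finset.sum_mul, sum_kerVec_swap, zero_mul, zero_smul]
    rw [this, map_zero, map_zero]
  have hsum : ∀ (i i' : Fin 3) (k : ℕ), k ∈ G →
      HasSum (fun j => Ψ j i' k * V j i k) (kerVec i' i) := by
    intro i i' k hk
    have h1 := ((blockCoord e σ w i k).comp
      ((blockSpace e σ w).subtypeL.comp w₀)).hasSum (f.expansion (u₀ (zz i' k)))
    convert h1 using 1
    · ext j
      simp [Ψ, V]
    · simp only [ContinuousLinearMap.comp_apply, hfac, Submodule.subtypeL_apply, hzz i' k hk,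
        blockCoord_blockVec hw hσ, if_true]
  -- The full sum over the basis is the trace `2` of the identity of the plane; the lower bound `1`
  -- leaves room for one finite set `J` that serves all `k ∈ G`.
  have htr : ∀ k ∈ G, ∀ᶠ J : Finset β in atTop,
      1 ≤ ‖∑ j ∈ J, (Ψ j 2 k * V j 0 k - Ψ j 0 k * V j 2 k)‖ := by
    intro k hk
    have h1 := ((hsum 0 2 k hk).sub (hsum 2 0 k hk)).norm
    have h2 : ‖(kerVec 2 0 : 𝕜) - kerVec 0 2‖ = 2 := by
      have : (kerVec 2 0 : 𝕜) - kerVec 0 2 = 2 := by simp [kerVec]; norm_num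
      rw [this]; simp
    rw [h2] at h1
    filter_upwards [h1.eventually (lt_mem_nhds (by norm_num : (1 : ℝ) < 2))] with J hJ
    exact hJ.le
  obtain ⟨J, hJ⟩ := ((Filter.eventually_all_finset G).2 htr).exists
  -- If all three sums were below `1/6`, the trace bound with its factor `2` would give `1 < 2 * 3 *
  -- (1/6)`.
  have hcol : ∀ k, ∃ i, k ∈ G → 1 / 6 ≤ ∑ j ∈ J, ‖V j i k * Ψ j i k‖ := by
    intro k
    by_cases hk : k ∈ G
    swap
    · exact ⟨0, fun h => absurd h hk⟩
    by_contra hcon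
    push Not at hcon
    have h1 : (1 : ℝ) ≤ ∑ j ∈ J, 2 * ∑ i, ‖V j i k * Ψ j i k‖ := by
      refine (hJ k hk).trans ((norm_sum_le _ _).trans (Finset.sum_le_sum fun j _ => ?_))
      rw [mul_comm (Ψ j 2 k), mul_comm (Ψ j 0 k)]
      exact norm_trace_rankOne_le (fun i => V j i k) (fun i => Ψ j i k) (hV j k) (hΨ j k hk)
    rw [← Finset.mul_sum, Finset.sum_comm, Fin.sum_univ_three] at h1
    have := (hcon 0).2
    have := (hcon 1).2
    have := (hcon 2).2
    linarith
  choose c hc using hcol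
  refine ⟨c, fun i E hEG hEc τ => ?_⟩
  choose θ hθ1 hθ2 using fun (k : ℕ) (j : β) => exists_norm_le_one_mul_eq_norm (V j i k * Ψ j i k)
  have hσi : Function.Injective (σ i) := fun k k' h => by
    have := @hσ (i, k) (i, k') h
    exact (Prod.mk.inj this).2
  have hei : IsUnconditionalWith 𝕜 1 (fun k => e (σ i k)) := he.comp_injective hσi
  let v : ℕ → β → 𝕜 := fun k j => e.coord (σ i k) (w₀ (f j) : X)
  have hvV : ∀ k j, v k j = (w i k : 𝕜) * V j i k := by
    intro k j
    have hne : (w i k : 𝕜) ≠ 0 := RCLike.ofReal_ne_zero.2 (hw i k).ne'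
    simp [v, V, blockCoord, hne]
  have hv : ∀ a : β → 𝕜, ‖∑ k ∈ E, matVec v J k a • e (σ i k)‖ ≤
      ‖w₀‖ * ‖∑ j ∈ J, a j • f j‖ := by
    intro a
    have h1 : ∀ k, matVec v J k a = e.coord (σ i k) (w₀ (∑ j ∈ J, a j • f j) : X) := by
      intro k
      simp only [matVec, v, map_sum, map_smul, Submodule.coe_sum, Submodule.coe_smul, smul_eq_mul]
      exact Finset.sum_congr rfl fun j _ => mul_comm _ _
    have h2 := IsUnconditionalWith.norm_sum_coord_le e he (E.map ⟨σ i, hσi⟩)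
      (w₀ (∑ j ∈ J, a j • f j) : X)
    rw [Finset.sum_map] at h2
    simp only [h1]
    exact h2.trans (w₀.le_opNorm _)
  -- The phases `θ` remove all cancellation from the diagonal entry of `a k` at row `k`, which
  -- becomes `τ k * w i k` times the sum of moduli, a number at least `1/6`. The off-diagonal
  -- entries need no control, as they only enlarge the square function.
  let a : ℕ → β → 𝕜 := fun k j => τ k * θ k j * Ψ j i k
  let h : β → ℝ := fun j => √(∑ k ∈ E, ‖a k j‖ ^ 2)
  have hK := norm_squareFunction_le hf hei J E v ‖w₀‖ (norm_nonneg _) hv h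
    (fun j => Real.sqrt_nonneg _) ℕ E a (fun j _ => by
      simp only [h]
      rw [Real.sq_sqrt (Finset.sum_nonneg fun _ _ => sq_nonneg _)])
  have hdiag : ∀ k ∈ E, ‖τ k * (w i k : 𝕜)‖ ≤
      ‖(6 : 𝕜) * ((√(∑ k' ∈ E, ‖matVec v J k (a k')‖ ^ 2) : ℝ) : 𝕜)‖ := by
    intro k hk
    have h1 : matVec v J k (a k) =
        τ k * (w i k : 𝕜) * ((∑ j ∈ J, ‖V j i k * Ψ j i k‖ : ℝ) : 𝕜) := by
      simp only [matVec, a, hvV]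
      rw [RCLike.ofReal_sum, Finset.mul_sum]
      refine Finset.sum_congr rfl fun j _ => ?_
      rw [← hθ2 k j]
      ring
    have h2 : ‖matVec v J k (a k)‖ ≤ √(∑ k' ∈ E, ‖matVec v J k (a k')‖ ^ 2) := by
      refine Real.le_sqrt_of_sq_le ?_
      exact Finset.single_le_sum (f := fun k' => ‖matVec v J k (a k')‖ ^ 2)
        (fun _ _ => sq_nonneg _) hk
    have h3 := hc k (hEG hk)
    rw [hEc k hk] at h3
    rw [h1, norm_mul, RCLike.norm_ofReal, abs_of_nonneg (by linarith)] at h2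
    have h6 : ‖(6 : 𝕜)‖ = 6 := by norm_num
    rw [norm_mul (6 : 𝕜), h6, RCLike.norm_ofReal, abs_of_nonneg (Real.sqrt_nonneg _)]
    have := mul_le_mul_of_nonneg_left h3 (norm_nonneg (τ k * (w i k : 𝕜)))
    linarith
  have hleft : layerNorm e σ w i E τ ≤
      12 * ‖∑ k ∈ E, ((√(∑ k' ∈ E, ‖matVec v J k (a k')‖ ^ 2) : ℝ) : 𝕜) • e (σ i k)‖ := by
    have h1 := hei.norm_sum_le_two_mul E _ _ hdiag
    simp only [mul_smul, ← Finset.smul_sum] at h1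
    have h6 : ‖(6 : 𝕜)‖ = 6 := by norm_num
    rw [norm_smul, h6] at h1
    simp only [layerNorm, mul_smul]
    linarith
  have hright : ‖∑ j ∈ J, (h j : 𝕜) • f j‖ ≤
      8 * (‖u₀‖ * ∑ j ∈ Finset.univ.erase i, layerNorm e σ w j E τ) := by
    refine norm_squareFunction_coord_le hf J E (fun k j => τ k * Ψ j i k) _ ?_ h ?_
    · intro r
      have h1 : ∀ j, ∑ k ∈ E, (r k : ℤ) • (τ k * Ψ j i k) =
          f.coord j (u₀ (∑ k ∈ E, (r k : ℤ) • τ k • zz i k)) := by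
        intro j
        simp only [map_sum, map_zsmul, map_smul, smul_eq_mul, Ψ]
      simp only [h1]
      refine (IsUnconditionalWith.norm_sum_coord_le f hf J _).trans ((u₀.le_opNorm _).trans ?_)
      refine mul_le_mul_of_nonneg_left ?_ (norm_nonneg _)
      have h2 : ‖∑ k ∈ E, (r k : ℤ) • τ k • zz i k‖ =
          ‖∑ k ∈ E, ((r k : ℤ) • τ k) • blockVec e σ w k (kerVec i)‖ := by
        change ‖(((∑ k ∈ E, (r k : ℤ) • τ k • zz i k : X₀) : blockSpace e σ w) : X)‖ = _
        simp only [Submodule.coe_sum]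
        congr 1
        refine Finset.sum_congr rfl fun k hk => ?_
        rw [← hzz i k (hEG hk), smul_assoc]
        rfl
      rw [h2]
      refine (norm_sum_blockVec_kerVec_le i E _).trans (Finset.sum_le_sum fun j _ => ?_)
      have hσj : Function.Injective (σ j) := fun k k' h => by
        have := @hσ (j, k) (j, k') h
        exact (Prod.mk.inj this).2
      have h3 := he.comp_injective hσj E (fun k => τ k * (w j k : 𝕜)) r
      rw [one_mul] at h3
      refine le_trans (le_of_eq ?_) h3
      simp only [layerNorm, smul_mul_assoc, smul_assoc]
    · intro j _
      refine ⟨Real.sqrt_nonneg _, Real.sqrt_le_sqrt (Finset.sum_le_sum fun k _ => ?_)⟩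
      refine pow_le_pow_left₀ (norm_nonneg _) ?_ 2
      simp only [a, norm_mul]
      have := mul_le_mul_of_nonneg_left (hθ1 k j) (norm_nonneg (τ k))
      have := mul_le_mul_of_nonneg_right this (norm_nonneg (Ψ j i k))
      linarith
  have hS : 0 ≤ ∑ j ∈ Finset.univ.erase i, layerNorm e σ w j E τ :=
    Finset.sum_nonneg fun _ _ => norm_nonneg _
  have h1 := mul_le_mul_of_nonneg_left hright (norm_nonneg w₀)
  have h2 := mul_le_mul_of_nonneg_right hC hS
  nlinarith

/-- Local unconditional structure of the block space forces, on every finite set of blocks, a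
colouring of the blocks such that on each colour the layer of that colour is dominated by the other
two layers. -/
theorem exists_coloring_of_localUnconditionalStructure
    (he : IsUnconditionalWith 𝕜 1 (fun l => e l))
    (hw : ∀ i k, 0 < w i k) (hσ : Function.Injective (fun q : Fin 3 × ℕ => σ q.1 q.2))
    (hY : HasLocalUnconditionalStructure 𝕜 (blockSpace e σ w)) :
    ∃ C : ℝ, ∀ G : Finset ℕ, ∃ c : ℕ → Fin 3, ∀ (i : Fin 3) (E : Finset ℕ), E ⊆ G →
      (∀ k ∈ E, c k = i) → ∀ τ : ℕ → 𝕜, layerNorm e σ w i E τ ≤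
        C * ∑ j ∈ Finset.univ.erase i, layerNorm e σ w j E τ := by
  classical
  obtain ⟨C, _, h⟩ := hY
  refine ⟨49152 * C, fun G => ?_⟩
  let z : Fin 3 × ℕ → blockSpace e σ w := fun q =>
    ⟨blockVec e σ w q.2 (kerVec q.1), blockVec_mem hw hσ q.2 (sum_kerVec q.1)⟩
  let T : Finset (blockSpace e σ w) := (Finset.univ ×ˢ G).image z
  obtain ⟨F, _, _, _, β, _, f, u₀, w₀, hf, hfac, hC⟩ :=
    h (Submodule.span 𝕜 (T : Set (blockSpace e σ w))) inferInstance
  refine exists_coloring_of_factorization he hw hσ G f hf _ (fun k hk i => ?_) u₀ w₀ hfac C hC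
  refine Submodule.subset_span ?_
  simp only [T, Finset.coe_image, Set.mem_image, Finset.mem_coe, Finset.mem_product,
    Finset.mem_univ, true_and]
  exact ⟨(i, k), hk, rfl⟩

end Coloring

/-! ### The unconditional decomposition of the block space into planes. -/

section Decomposition

variable {𝕜 : Type v} [RCLike 𝕜] {X : Type u} [NormedAddCommGroup X] [NormedSpace 𝕜 X]
  {e : SchauderBasis 𝕜 X} {σ : Fin 3 → ℕ → ℕ} {w : Fin 3 → ℕ → ℝ}

theorem eq_of_forall_coord_eq (e : SchauderBasis 𝕜 X) {y z : X}
    (h : ∀ l, e.coord l y = e.coord l z) : y = z := by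
  have h1 := e.expansion y
  have h2 := e.expansion z
  simp only [h] at h1
  exact h1.unique h2

theorem coord_blockVec_of_ne {k l : ℕ}
    (hl : ∀ i, σ i k ≠ l) (a : Fin 3 → 𝕜) : e.coord l (blockVec e σ w k a) = 0 := by
  simp only [blockVec, map_sum, map_smul, coord_basis_apply]
  refine Finset.sum_eq_zero fun i _ => ?_
  rw [if_neg (fun h => hl i h.symm), smul_zero]

theorem blockVec_blockCoord (hw : ∀ i k, 0 < w i k) (k : ℕ) (y : X) :
    blockVec e σ w k (fun i => blockCoord e σ w i k y) =
      ∑ i, e.coord (σ i k) y • e (σ i k) := by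
  refine Finset.sum_congr rfl fun i _ => ?_
  have hne : (w i k : 𝕜) ≠ 0 := RCLike.ofReal_ne_zero.2 (hw i k).ne'
  congr 1
  simp only [blockCoord, smul_apply, smul_eq_mul]
  field_simp

theorem sum_blockCoord_eq_zero (y : blockSpace e σ w) (k : ℕ) :
    ∑ i, blockCoord e σ w i k (y : X) = 0 := y.2.2 k

/-- The vectors spanning the `k`-th summand of the decomposition of the block space. -/
noncomputable def blockPair (e : SchauderBasis 𝕜 X) (hw : ∀ i k, 0 < w i k)
    (hσ : Function.Injective (fun q : Fin 3 × ℕ => σ q.1 q.2)) (k : ℕ) :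
    Fin 2 → blockSpace e σ w :=
  ![⟨blockVec e σ w k (kerVec 2), blockVec_mem hw hσ k (sum_kerVec 2)⟩,
    ⟨blockVec e σ w k (kerVec 0), blockVec_mem hw hσ k (sum_kerVec 0)⟩]

theorem linearIndependent_blockPair (hw : ∀ i k, 0 < w i k)
    (hσ : Function.Injective (fun q : Fin 3 × ℕ => σ q.1 q.2)) (k : ℕ) :
    LinearIndependent 𝕜 (blockPair e hw hσ k) := by
  rw [blockPair, LinearIndependent.pair_iff]
  intro s t hst
  have h1 : s • blockVec e σ w k (kerVec 2) + t • blockVec e σ w k (kerVec 0) = 0 :=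
    congrArg Subtype.val hst
  have h0 := congrArg (blockCoord e σ w 0 k) h1
  have h2 := congrArg (blockCoord e σ w 2 k) h1
  simp only [map_add, map_smul, blockCoord_blockVec hw hσ, if_true, map_zero] at h0 h2
  simp [kerVec] at h0 h2
  exact ⟨h0, h2⟩

/-- The `k`-th summand of the decomposition of the block space. -/
noncomputable def blockSummand (e : SchauderBasis 𝕜 X) (hw : ∀ i k, 0 < w i k)
    (hσ : Function.Injective (fun q : Fin 3 × ℕ => σ q.1 q.2)) (k : ℕ) :
    Submodule 𝕜 (blockSpace e σ w) :=
  Submodule.span 𝕜 (Set.range (blockPair e hw hσ k))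

theorem coord_eq_zero_of_mem_blockSummand (hw : ∀ i k, 0 < w i k)
    (hσ : Function.Injective (fun q : Fin 3 × ℕ => σ q.1 q.2)) {k l : ℕ}
    (hl : ∀ i, σ i k ≠ l) {y : blockSpace e σ w} (hy : y ∈ blockSummand e hw hσ k) :
    e.coord l (y : X) = 0 := by
  have hle : blockSummand e hw hσ k ≤
      LinearMap.ker ((e.coord l).toLinearMap ∘ₗ (blockSpace e σ w).subtype) := by
    rw [blockSummand, Submodule.span_le]
    rintro _ ⟨i, rfl⟩
    fin_cases i <;> exact coord_blockVec_of_ne hl _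
  exact hle hy

theorem blockVec_mem_blockSummand (hw : ∀ i k, 0 < w i k)
    (hσ : Function.Injective (fun q : Fin 3 × ℕ => σ q.1 q.2)) (k : ℕ) {a : Fin 3 → 𝕜}
    (ha : ∑ i, a i = 0) :
    (⟨blockVec e σ w k a, blockVec_mem hw hσ k ha⟩ : blockSpace e σ w) ∈
      blockSummand e hw hσ k := by
  have h : (⟨blockVec e σ w k a, blockVec_mem hw hσ k ha⟩ : blockSpace e σ w) =
      a 0 • blockPair e hw hσ k 0 + (- a 2) • blockPair e hw hσ k 1 := by
    apply Subtype.ext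
    have ha1 : a 1 = - a 0 - a 2 := by
      rw [Fin.sum_univ_three] at ha
      linear_combination ha
    simp [blockPair, blockVec, Fin.sum_univ_three, kerVec, ha1, smul_smul, sub_mul, sub_smul]
    abel
  rw [h]
  exact Submodule.add_mem _
    (Submodule.smul_mem _ _ (Submodule.subset_span ⟨0, rfl⟩))
    (Submodule.smul_mem _ _ (Submodule.subset_span ⟨1, rfl⟩))

theorem blockVec_blockCoord_of_mem (hw : ∀ i k, 0 < w i k)
    (hσ : Function.Injective (fun q : Fin 3 × ℕ => σ q.1 q.2)) {k : ℕ} {y : blockSpace e σ w}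
    (hy : y ∈ blockSummand e hw hσ k) :
    (y : X) = ∑ i, e.coord (σ i k) (y : X) • e (σ i k) := by
  rw [← blockVec_blockCoord hw]
  refine eq_of_forall_coord_eq e fun l => ?_
  by_cases hl : ∃ i, σ i k = l
  · obtain ⟨i, rfl⟩ := hl
    have hne : (w i k : 𝕜)⁻¹ ≠ 0 := inv_ne_zero (RCLike.ofReal_ne_zero.2 (hw i k).ne')
    have h1 := blockCoord_blockVec (e := e) hw hσ i k k (fun i => blockCoord e σ w i k (y : X))
    rw [if_pos rfl] at h1
    exact (mul_left_cancel₀ hne h1).symm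
  · push Not at hl
    rw [coord_eq_zero_of_mem_blockSummand hw hσ hl hy, coord_blockVec_of_ne hl]

/-- The partial sums follow the order of the triples, not of the basis. All coordinate projections
are contractions, so it suffices to treat a finite partial sum of the basis expansion: its indices
are eventually covered by triples or carry a zero coordinate. -/
theorem tendsto_sum_coord_blockSpace (he : IsUnconditionalWith 𝕜 1 (fun l => e l))
    (hσ : Function.Injective (fun q : Fin 3 × ℕ => σ q.1 q.2)) (y : X)
    (hy : y ∈ blockSpace e σ w) :
    Tendsto (fun n => ∑ k ∈ Finset.range n, ∑ i, e.coord (σ i k) y • e (σ i k)) atTop (𝓝 y) := by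
  classical
  let S : ℕ → Finset ℕ := fun n =>
    (Finset.range n ×ˢ (Finset.univ : Finset (Fin 3))).map
      ⟨fun q => σ q.2 q.1, fun q q' h => by
        have := @hσ (q.2, q.1) (q'.2, q'.1) h
        rw [Prod.mk.injEq] at this
        exact Prod.ext this.2 this.1⟩
  have hS : ∀ n, ∑ k ∈ Finset.range n, ∑ i, e.coord (σ i k) y • e (σ i k) =
      GeneralSchauderBasis.proj e (S n) y := by
    intro n
    rw [GeneralSchauderBasis.proj_apply, Finset.sum_map, Finset.sum_product]
    rfl
  simp only [hS]
  rw [Metric.tendsto_atTop]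
  intro ε hε
  obtain ⟨N, hN⟩ := (Metric.tendsto_atTop.1 (SchauderBasis.tendsto_proj e y)) (ε / 2) (half_pos hε)
  have hN := hN N le_rfl
  rw [SchauderBasis.proj, dist_eq_norm] at hN
  have hcov : ∀ l ∈ Finset.range N, ∀ᶠ n in atTop, l ∈ S n ∨ e.coord l y = 0 := by
    intro l _
    by_cases hl : ∃ i k, σ i k = l
    · obtain ⟨i, k, rfl⟩ := hl
      filter_upwards [eventually_gt_atTop k] with n hn
      left
      simp only [S, Finset.mem_map, Finset.mem_product, Finset.mem_range, Finset.mem_univ,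
        and_true]
      exact ⟨(k, i), hn, rfl⟩
    · push Not at hl
      exact Eventually.of_forall fun n => Or.inr (hy.1 l hl)
  obtain ⟨n₀, hn₀⟩ := eventually_atTop.1 ((Filter.eventually_all_finset _).2 hcov)
  refine ⟨n₀, fun n hn => ?_⟩
  set v := GeneralSchauderBasis.proj e (Finset.range N) y with hv
  have hPv : GeneralSchauderBasis.proj e (S n) v = v := by
    rw [hv, GeneralSchauderBasis.proj_apply e (Finset.range N), map_sum]
    refine Finset.sum_congr rfl fun l hl => ?_
    rw [map_smul]
    rcases hn₀ n hn l hl with h | h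
    · rw [GeneralSchauderBasis.proj_apply_basis_mem, if_pos h]
    · rw [h, zero_smul, zero_smul]
  have h1 : ‖GeneralSchauderBasis.proj e (S n) (y - v)‖ ≤ ‖y - v‖ := by
    rw [GeneralSchauderBasis.proj_apply]
    exact IsUnconditionalWith.norm_sum_coord_le e he (S n) (y - v)
  rw [dist_eq_norm]
  have h2 : GeneralSchauderBasis.proj e (S n) y - y =
      GeneralSchauderBasis.proj e (S n) (y - v) + (v - y) := by
    rw [map_sub, hPv]
    abel
  rw [h2]
  rw [norm_sub_rev] at h1
  calc _ ≤ _ := norm_add_le _ _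
    _ < ε := by linarith

theorem hasUnconditionalDecomposition_blockSpace (he : IsUnconditionalWith 𝕜 1 (fun l => e l))
    (hw : ∀ i k, 0 < w i k) (hσ : Function.Injective (fun q : Fin 3 × ℕ => σ q.1 q.2)) :
    HasUnconditionalDecomposition 𝕜 (blockSpace e σ w) 2 := by
  classical
  refine ⟨blockSummand e hw hσ, ⟨fun k => ?_, fun y => ?_⟩, fun k => ?_, 1, fun s z ε hz => ?_⟩
  · have : FiniteDimensional 𝕜 (blockSummand e hw hσ k) :=
      FiniteDimensional.span_of_finite 𝕜 (Set.finite_range _)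
    exact Submodule.closed_of_finiteDimensional _
  · refine ⟨fun k => ⟨blockVec e σ w k (fun i => blockCoord e σ w i k (y : X)),
      blockVec_mem hw hσ k (sum_blockCoord_eq_zero y k)⟩, ⟨fun k => ?_, ?_⟩, ?_⟩
    · exact blockVec_mem_blockSummand hw hσ k (sum_blockCoord_eq_zero y k)
    · rw [tendsto_subtype_rng]
      simp only [Submodule.coe_sum, blockVec_blockCoord hw]
      exact tendsto_sum_coord_blockSpace he hσ (y : X) y.2
    · rintro z ⟨hz, hlim⟩
      funext k
      apply Subtype.ext
      refine (blockVec_blockCoord_of_mem hw hσ (hz k)).trans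
        (Eq.trans ?_ (blockVec_blockCoord hw k (y : X)).symm)
      refine Finset.sum_congr rfl fun i _ => ?_
      congr 1
      -- Uniqueness: only the `k`-th summand sees the coordinate `σ i k`, so along the partial sums
      -- this coordinate is eventually constant.
      have h1 : Tendsto (fun n => e.coord (σ i k) ((∑ k' ∈ Finset.range n, z k' : blockSpace e σ w) : X))
          atTop (𝓝 (e.coord (σ i k) (y : X))) :=
        ((e.coord (σ i k)).continuous.tendsto _).comp (tendsto_subtype_rng.1 hlim)
      refine tendsto_nhds_unique (tendsto_const_nhds.congr' ?_) h1
      filter_upwards [eventually_gt_atTop k] with n hn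
      rw [Submodule.coe_sum, map_sum, Finset.sum_eq_single_of_mem k (Finset.mem_range.2 hn)]
      intro k' _ hk'
      refine coord_eq_zero_of_mem_blockSummand hw hσ (fun j h => hk' ?_) (hz k')
      exact (Prod.mk.inj (@hσ (j, k') (i, k) h)).2
  · rw [blockSummand, finrank_span_eq_card (linearIndependent_blockPair hw hσ k), Fintype.card_fin]
  -- Signs on planes are signs on basis vectors that are constant on each triple, hence the constant
  -- `1`.
  · have h1 := he.comp_injective hσ
      ((s ×ˢ (Finset.univ : Finset (Fin 3))).map ⟨Prod.swap, Prod.swap_injective⟩)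
      (fun q => e.coord (σ q.1 q.2) (z q.2 : X)) (fun q => ε q.2)
    simp only [Finset.sum_map, Finset.sum_product, Function.Embedding.coeFn_mk, Prod.fst_swap,
      Prod.snd_swap, ← Finset.smul_sum] at h1
    change ‖((∑ k ∈ s, (ε k : ℤ) • z k : blockSpace e σ w) : X)‖ ≤
      1 * ‖((∑ k ∈ s, z k : blockSpace e σ w) : X)‖
    have h2 : ∀ k, (z k : X) = ∑ i, e.coord (σ i k) (z k : X) • e (σ i k) := fun k =>
      blockVec_blockCoord_of_mem hw hσ (hz k)
    convert h1 using 3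
    · rw [Submodule.coe_sum]
      refine Finset.sum_congr rfl fun k _ => ?_
      rw [Submodule.coe_smul_of_tower]
      congr 1
      exact h2 k
    · rw [Submodule.coe_sum]
      exact Finset.sum_congr rfl fun k _ => h2 k

end Decomposition

/-! ### Separating configurations and their union. -/

section Configurations

variable {𝕜 : Type v} [RCLike 𝕜] {X : Type u} [NormedAddCommGroup X] [NormedSpace 𝕜 X]
  {α : Type*}

/-- A finite configuration of triples of vectors of the family `x`, with weights, avoiding `V`, such
that for every colouring there are a colour and a combination over blocks of that colour for which
the layer of that colour is `R` times larger than the other two layers together. -/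
def HasSeparatingConfiguration (𝕜 : Type v) {X : Type u} [RCLike 𝕜] [NormedAddCommGroup X]
    [NormedSpace 𝕜 X] {α : Type*} (x : α → X) (R : ℝ) (V : Finset α) : Prop :=
  ∃ (K : Finset (ℕ × ℕ)) (σ : Fin 3 → ℕ × ℕ → α) (w : Fin 3 → ℝ), (∀ i, 0 < w i) ∧
    (∀ i j, ∀ k ∈ K, ∀ l ∈ K, σ i k = σ j l → i = j ∧ k = l) ∧
    (∀ i, ∀ k ∈ K, σ i k ∉ V) ∧
    ∀ c : ℕ × ℕ → Fin 3, ∃ i, ∃ E ⊆ K, (∀ k ∈ E, c k = i) ∧ ∃ τ : ℕ × ℕ → 𝕜,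
      R * ∑ j ∈ Finset.univ.erase i, w j * ‖∑ k ∈ E, τ k • x (σ j k)‖ <
        w i * ‖∑ k ∈ E, τ k • x (σ i k)‖

/-- Successive choices, each of which depends on the finite set of points used so far. -/
theorem exists_seq_of_forall_finset {α γ : Type*} [DecidableEq α] (supp : γ → Finset α)
    (P : ℕ → Finset α → γ → Prop) (h : ∀ n V, ∃ a, P n V a) (V₀ : Finset α) :
    ∃ (a : ℕ → γ) (V : ℕ → Finset α), (∀ n, P n (V n) (a n)) ∧ (∀ n, V₀ ⊆ V n) ∧
      ∀ m n, m < n → supp (a m) ⊆ V n := by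
  choose f hf using h
  let V : ℕ → Finset α := fun n => Nat.rec V₀ (fun n W => W ∪ supp (f n W)) n
  have hV : ∀ n, V (n + 1) = V n ∪ supp (f n (V n)) := fun _ => rfl
  have hmono : Monotone V := monotone_nat_of_le_succ fun n => by
    rw [hV]; exact Finset.subset_union_left
  refine ⟨fun n => f n (V n), V, fun n => hf n (V n), fun n => hmono (Nat.zero_le n),
    fun m n hmn => ?_⟩
  refine Finset.Subset.trans ?_ (hmono hmn)
  change _ ⊆ V (m + 1)
  rw [hV]
  exact Finset.subset_union_right

/-- Configurations with factors `R = 0, 1, 2, …` are chosen so that each avoids the vectors used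
before; their index sets are strung together by an enumeration of the disjoint union. A colouring
bound with one constant is then refuted by a later configuration. -/
theorem exists_infinite_configuration (x : α → X)
    (h : ∀ (R : ℝ) (V : Finset α), HasSeparatingConfiguration 𝕜 x R V) :
    ∃ (σ : Fin 3 → ℕ → α) (w : Fin 3 → ℕ → ℝ), (∀ i k, 0 < w i k) ∧
      Function.Injective (fun q : Fin 3 × ℕ => σ q.1 q.2) ∧
      ∀ n : ℕ, ∃ G : Finset ℕ, ∀ c : ℕ → Fin 3, ∃ i, ∃ E ⊆ G, (∀ k ∈ E, c k = i) ∧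
        ∃ τ : ℕ → 𝕜, n * ∑ j ∈ Finset.univ.erase i,
          ‖∑ k ∈ E, (τ k * (w j k : 𝕜)) • x (σ j k)‖ <
          ‖∑ k ∈ E, (τ k * (w i k : 𝕜)) • x (σ i k)‖ := by
  classical
  let γ := Finset (ℕ × ℕ) × (Fin 3 → ℕ × ℕ → α) × (Fin 3 → ℝ)
  obtain ⟨a, V, ha, -, hV⟩ := exists_seq_of_forall_finset (γ := γ)
    (fun d => (Finset.univ ×ˢ d.1).image fun q => d.2.1 q.1 q.2)
    (fun n V d => (∀ i, 0 < d.2.2 i) ∧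
      (∀ i j, ∀ k ∈ d.1, ∀ l ∈ d.1, d.2.1 i k = d.2.1 j l → i = j ∧ k = l) ∧
      (∀ i, ∀ k ∈ d.1, d.2.1 i k ∉ V) ∧
      ∀ c : ℕ × ℕ → Fin 3, ∃ i, ∃ E ⊆ d.1, (∀ k ∈ E, c k = i) ∧ ∃ τ : ℕ × ℕ → 𝕜,
        n * ∑ j ∈ Finset.univ.erase i, d.2.2 j * ‖∑ k ∈ E, τ k • x (d.2.1 j k)‖ <
          d.2.2 i * ‖∑ k ∈ E, τ k • x (d.2.1 i k)‖)
    (fun n V => by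
      obtain ⟨K, σ, w, h1⟩ := h n V
      exact ⟨(K, σ, w), h1⟩) ∅
  let I := Σ n, {k // k ∈ (a n).1}
  -- An empty configuration would assert `0 < 0`. Nonemptiness makes the disjoint union infinite, so
  -- it can be enumerated by all of `ℕ`.
  have hne : ∀ n, Nonempty {k // k ∈ (a n).1} := by
    intro n
    obtain ⟨i, E, hE, -, τ, hτ⟩ := (ha n).2.2.2 (fun _ => 0)
    by_contra hemp
    have : E = ∅ := by
      refine Finset.eq_empty_of_forall_notMem fun k hk => hemp ⟨⟨k, hE hk⟩⟩
    subst this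
    simp at hτ
  have : Infinite I := Infinite.of_injective (fun n => (⟨n, (hne n).some⟩ : I))
    (fun m n hmn => congrArg Sigma.fst hmn)
  obtain ⟨ε⟩ : Nonempty (ℕ ≃ I) := nonempty_equiv_of_countable
  refine ⟨fun i m => (a (ε m).1).2.1 i (ε m).2.1, fun i m => (a (ε m).1).2.2 i,
    fun i m => (ha _).1 i, ?_, fun n => ?_⟩
  · have key : ∀ (i j : Fin 3) (y z : I),
        (a y.1).2.1 i y.2.1 = (a z.1).2.1 j z.2.1 → i = j ∧ y = z := by
      have hlt : ∀ (i j : Fin 3) (y z : I), y.1 < z.1 →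
          (a y.1).2.1 i y.2.1 ≠ (a z.1).2.1 j z.2.1 := by
        intro i j y z hyz heq
        refine (ha z.1).2.2.1 j z.2.1 z.2.2 (hV y.1 z.1 hyz ?_)
        rw [← heq]
        exact Finset.mem_image.2
          ⟨(i, y.2.1), Finset.mem_product.2 ⟨Finset.mem_univ _, y.2.2⟩, rfl⟩
      intro i j y z heq
      rcases lt_trichotomy y.1 z.1 with hyz | hyz | hyz
      · exact absurd heq (hlt i j y z hyz)
      · obtain ⟨n, k, hk⟩ := y
        obtain ⟨m, l, hl⟩ := z
        subst hyz
        obtain ⟨h1, h2⟩ := (ha n).2.1 i j k hk l hl heq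
        refine ⟨h1, ?_⟩
        subst h2
        rfl
      · exact absurd heq.symm (hlt j i z y hyz)
    rintro ⟨i, m⟩ ⟨j, l⟩ heq
    obtain ⟨h1, h2⟩ := key i j (ε m) (ε l) heq
    exact Prod.ext h1 (ε.injective h2)
  · let emb : {k // k ∈ (a n).1} ↪ ℕ :=
      ⟨fun k => ε.symm ⟨n, k⟩, fun k l hkl =>
        eq_of_heq (Sigma.mk.inj (ε.symm.injective hkl)).2⟩
    have hemb : ∀ k, ε (emb k) = ⟨n, k⟩ := fun k => ε.apply_symm_apply _
    refine ⟨Finset.univ.map emb, fun c => ?_⟩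
    obtain ⟨i, E, hE, hEc, τ, hτ⟩ := (ha n).2.2.2
      (fun k => if hk : k ∈ (a n).1 then c (emb ⟨k, hk⟩) else 0)
    have hsum : ∀ j, ‖∑ m ∈ (E.subtype (· ∈ (a n).1)).map emb,
        (τ (ε m).2.1 * ((a (ε m).1).2.2 j : 𝕜)) • x ((a (ε m).1).2.1 j (ε m).2.1)‖ =
        (a n).2.2 j * ‖∑ k ∈ E, τ k • x ((a n).2.1 j k)‖ := by
      intro j
      rw [Finset.sum_map]
      let φ : I → X := fun y => (τ y.2.1 * ((a y.1).2.2 j : 𝕜)) • x ((a y.1).2.1 j y.2.1)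
      rw [Finset.sum_congr rfl fun k _ => congrArg φ (hemb k)]
      simp only [φ]
      rw [Finset.sum_subtype_of_mem
        (f := fun k => (τ k * ((a n).2.2 j : 𝕜)) • x ((a n).2.1 j k)) (fun k hk => hE hk)]
      have : ∑ k ∈ E, (τ k * ((a n).2.2 j : 𝕜)) • x ((a n).2.1 j k) =
          ((a n).2.2 j : 𝕜) • ∑ k ∈ E, τ k • x ((a n).2.1 j k) := by
        rw [Finset.smul_sum]
        refine Finset.sum_congr rfl fun k _ => ?_
        rw [smul_smul, mul_comm]
      rw [this, norm_smul, RCLike.norm_ofReal, abs_of_pos ((ha n).1 j)]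
    refine ⟨i, (E.subtype (· ∈ (a n).1)).map emb, Finset.map_subset_map.2 (Finset.subset_univ _),
      fun m hm => ?_, fun m => τ (ε m).2.1, ?_⟩
    · obtain ⟨k, hk, rfl⟩ := Finset.mem_map.1 hm
      have := hEc k.1 (Finset.mem_subtype.1 hk)
      rwa [dif_pos k.2] at this
    · simp only [hsum]
      exact hτ

/-- If the family of basis vectors indexed by `g` has separating configurations, some subspace has
the required properties. -/
theorem exists_subspace_of_separatingConfigurations (e : SchauderBasis 𝕜 X)
    (he : IsUnconditionalWith 𝕜 1 (fun l => e l)) (g : α → ℕ) (hg : Function.Injective g)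
    (h : ∀ (R : ℝ) (V : Finset α), HasSeparatingConfiguration 𝕜 (fun a => e (g a)) R V) :
    ∃ Y : Submodule 𝕜 X, IsClosed (Y : Set X) ∧
      ¬ HasLocalUnconditionalStructure 𝕜 Y ∧ HasUnconditionalDecomposition 𝕜 Y 2 := by
  obtain ⟨σ, w, hw, hσ, hsep⟩ := exists_infinite_configuration _ h
  have hσ' : Function.Injective (fun q : Fin 3 × ℕ => g (σ q.1 q.2)) := hg.comp hσ
  refine ⟨blockSpace e (fun i k => g (σ i k)) w, isClosed_blockSpace, fun hlust => ?_,
    hasUnconditionalDecomposition_blockSpace he hw hσ'⟩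
  obtain ⟨C, hC⟩ := exists_coloring_of_localUnconditionalStructure he hw hσ' hlust
  obtain ⟨n, hn⟩ := exists_nat_ge C
  obtain ⟨G, hG⟩ := hsep n
  obtain ⟨c, hc⟩ := hC G
  obtain ⟨i, E, hE, hEc, τ, hτ⟩ := hG c
  have h1 := hc i E hE hEc τ
  have h2 : 0 ≤ ∑ j ∈ Finset.univ.erase i, layerNorm e (fun i k => g (σ i k)) w j E τ :=
    Finset.sum_nonneg fun _ _ => norm_nonneg _
  have h3 := mul_le_mul_of_nonneg_right hn h2
  simp only [layerNorm] at h1 h3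
  linarith

end Configurations

/-! ### Finite `l_p` norms over arbitrary index types. -/

section FiniteLpNorm

variable {𝕜 : Type v} [RCLike 𝕜] {ι κ : Type*}

/-- The `l_p` norm of finitely many coefficients. -/
noncomputable def finLpNorm (p : ℝ) (s : Finset ι) (t : ι → 𝕜) : ℝ :=
  (∑ i ∈ s, ‖t i‖ ^ p) ^ (1 / p)

theorem finLpNorm_nonneg (p : ℝ) (s : Finset ι) (t : ι → 𝕜) : 0 ≤ finLpNorm p s t :=
  Real.rpow_nonneg (Finset.sum_nonneg fun _ _ => Real.rpow_nonneg (norm_nonneg _) _) _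

theorem finLpNorm_mono {p : ℝ} (hp : 1 ≤ p) {s s' : Finset ι} (h : s ⊆ s') (t : ι → 𝕜) :
    finLpNorm p s t ≤ finLpNorm p s' t := by
  refine Real.rpow_le_rpow (Finset.sum_nonneg fun _ _ => Real.rpow_nonneg (norm_nonneg _) _) ?_
    (by positivity)
  exact Finset.sum_le_sum_of_subset_of_nonneg h fun _ _ _ => Real.rpow_nonneg (norm_nonneg _) _

theorem finLpNorm_singleton {p : ℝ} (hp : 1 ≤ p) (i : ι) (t : ι → 𝕜) :
    finLpNorm p {i} t = ‖t i‖ := by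
  rw [finLpNorm, Finset.sum_singleton, ← Real.rpow_mul (norm_nonneg _),
    mul_one_div_cancel (by positivity), Real.rpow_one]

theorem norm_le_finLpNorm {p : ℝ} (hp : 1 ≤ p) {s : Finset ι} {i : ι} (hi : i ∈ s) (t : ι → 𝕜) :
    ‖t i‖ ≤ finLpNorm p s t := by
  rw [← finLpNorm_singleton hp i t]
  exact finLpNorm_mono hp (Finset.singleton_subset_iff.2 hi) t

theorem finLpNorm_congr {p : ℝ} {s : Finset ι} {t t' : ι → 𝕜} (h : ∀ i ∈ s, t i = t' i) :
    finLpNorm p s t = finLpNorm p s t' := by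
  unfold finLpNorm
  rw [Finset.sum_congr rfl fun i hi => by rw [h i hi]]

theorem finLpNorm_map (p : ℝ) (s : Finset ι) (g : ι ↪ κ) (t : κ → 𝕜) :
    finLpNorm p (s.map g) t = finLpNorm p s (fun i => t (g i)) := by
  rw [finLpNorm, Finset.sum_map]
  rfl

theorem finLpNorm_image [DecidableEq κ] (p : ℝ) {s : Finset ι} {g : ι → κ}
    (hg : Set.InjOn g s) (t : κ → 𝕜) :
    finLpNorm p (s.image g) t = finLpNorm p s (fun i => t (g i)) := by
  rw [finLpNorm, Finset.sum_image hg]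
  rfl

theorem finLpNorm_empty {p : ℝ} (hp : 1 ≤ p) (t : ι → 𝕜) : finLpNorm p ∅ t = 0 := by
  rw [finLpNorm, Finset.sum_empty, Real.zero_rpow (by positivity)]

/-- Extending the coefficients by zero does not change the `l_p` norm. -/
theorem finLpNorm_ite [DecidableEq ι] {p : ℝ} (hp : 1 ≤ p) {s s' : Finset ι} (h : s ⊆ s')
    (t : ι → 𝕜) : finLpNorm p s' (fun i => if i ∈ s then t i else 0) = finLpNorm p s t := by
  unfold finLpNorm
  congr 1
  rw [← Finset.sum_subset h]
  · exact Finset.sum_congr rfl fun i hi => by simp only [if_pos hi]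
  · intro i _ hi
    simp only [if_neg hi]
    rw [norm_zero, Real.zero_rpow (by positivity)]

theorem sum_ite_smul_of_subset [DecidableEq ι] {X : Type*} [NormedAddCommGroup X]
    [NormedSpace 𝕜 X] {s s' : Finset ι} (h : s ⊆ s') (t : ι → 𝕜) (x : ι → X) :
    ∑ i ∈ s', (if i ∈ s then t i else 0) • x i = ∑ i ∈ s, t i • x i := by
  rw [← Finset.sum_subset h]
  · exact Finset.sum_congr rfl fun i hi => by rw [if_pos hi]
  · intro i _ hi
    rw [if_neg hi, zero_smul]

end FiniteLpNorm

/-! ### Large sets, transversals, row systems and König's lemma. -/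

section Blocks

variable {α : Type*}

/-- A set that meets the blocks in arbitrarily many elements. -/
def IsLargeSet (blk : α → ℕ) (H : Set α) : Prop :=
  ∀ n : ℕ, ∃ A : Finset α, (A : Set α) ⊆ H ∧ n ≤ A.card ∧ ∃ y, n ≤ y ∧ ∀ a ∈ A, blk a = y

theorem IsLargeSet.exists_block {blk : α → ℕ} {H : Set α} (hH : IsLargeSet blk H) (n m : ℕ) :
    ∃ (ρ : ℕ → α) (y : ℕ), m < y ∧ (∀ i < n, ρ i ∈ H ∧ blk (ρ i) = y) ∧
      ∀ i < n, ∀ j < n, ρ i = ρ j → i = j := by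
  obtain ⟨A, hAH, hAc, y, hy, hAy⟩ := hH (n + m + 1)
  have hne : Nonempty α := by
    have : A.Nonempty := Finset.card_pos.1 (by omega)
    exact ⟨this.choose⟩
  refine ⟨fun i => if h : i < A.card then (A.equivFin.symm ⟨i, h⟩ : α) else hne.some, y, by omega,
    fun i hi => ?_, fun i hi j hj hij => ?_⟩
  · have hi' : i < A.card := by omega
    simp only [dif_pos hi']
    exact ⟨hAH (A.equivFin.symm ⟨i, hi'⟩).2, hAy _ (A.equivFin.symm ⟨i, hi'⟩).2⟩
  · have hi' : i < A.card := by omega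
    have hj' : j < A.card := by omega
    simp only [dif_pos hi', dif_pos hj'] at hij
    have := A.equivFin.symm.injective (Subtype.ext hij)
    simpa using this

/-- A sequence of elements of `H` in strictly increasing blocks beyond `m`. -/
def IsTransversal (blk : α → ℕ) (H : Set α) (m : ℕ) (κ : ℕ → α) : Prop :=
  (∀ j, κ j ∈ H) ∧ (∀ j, m < blk (κ j)) ∧ StrictMono fun j => blk (κ j)

theorem IsTransversal.injective {blk : α → ℕ} {H : Set α} {m : ℕ} {κ : ℕ → α}
    (h : IsTransversal blk H m κ) : Function.Injective κ :=
  fun _ _ hij => h.2.2.injective (congrArg blk hij)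

theorem IsLargeSet.exists_transversal {blk : α → ℕ} {H : Set α} (hH : IsLargeSet blk H) (m : ℕ) :
    ∃ κ : ℕ → α, IsTransversal blk H m κ := by
  have h1 : ∀ n, ∃ a ∈ H, n < blk a := by
    intro n
    obtain ⟨ρ, y, hy, h, -⟩ := hH.exists_block 1 n
    exact ⟨ρ 0, (h 0 one_pos).1, (h 0 one_pos).2 ▸ hy⟩
  choose g hgH hg using h1
  let κ : ℕ → α := fun j => Nat.rec (g m) (fun _ a => g (blk a)) j
  have hmono : StrictMono fun j => blk (κ j) := strictMono_nat_of_lt_succ fun j => hg _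
  refine ⟨κ, fun j => ?_, fun j => ?_, hmono⟩
  · cases j <;> exact hgH _
  · exact lt_of_lt_of_le (hg m) (hmono.monotone (Nat.zero_le j))

/-- Rows of pairs of elements: the first entries of a row come in arbitrary blocks, the second
entries in a single later block, and later rows come in later blocks. -/
structure IsRowSystem (blk : α → ℕ) (H : Set α) (m : ℕ) (n : ℕ → ℕ) (D B : ℕ → ℕ → α) :
    Prop where
  pos : ∀ x, 0 < n x
  memD : ∀ x, ∀ i < n x, D x i ∈ H
  memB : ∀ x, ∀ i < n x, B x i ∈ H
  injD : ∀ x, ∀ i < n x, ∀ j < n x, D x i = D x j → i = j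
  injB : ∀ x, ∀ i < n x, ∀ j < n x, B x i = B x j → i = j
  blkB : ∀ x, ∀ i < n x, ∀ j < n x, blk (B x i) = blk (B x j)
  beyond : ∀ x, ∀ i < n x, m < blk (D x i)
  ltDB : ∀ x, ∀ i < n x, ∀ j < n x, blk (D x i) < blk (B x j)
  ltBD : ∀ x x', x < x' → ∀ i < n x, ∀ j < n x', blk (B x i) < blk (D x' j)

/-- The property `P` is imposed on the first entries alone, so the second entries may be any `n x`
members of one block beyond them. -/
theorem exists_rowSystem {blk : α → ℕ} {H : Set α} (hH : IsLargeSet blk H)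
    (P : (ℕ → α) → ℕ → Prop)
    (hP : ∀ m, ∃ κ : ℕ → α, (∀ i, κ i ∈ H ∧ m < blk (κ i)) ∧ Function.Injective κ ∧
      ∃ n, 0 < n ∧ P κ n) (m : ℕ) :
    ∃ (n : ℕ → ℕ) (D B : ℕ → ℕ → α), IsRowSystem blk H m n D B ∧ ∀ x, P (D x) (n x) := by
  classical
  let γ := ℕ × (ℕ → α) × (ℕ → α)
  -- An element in a block beyond `m` seeds the finite set to be avoided, so that every row lies
  -- beyond `m`.
  obtain ⟨ρ₀, y₀, hy₀, hρ₀, -⟩ := hH.exists_block 1 m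
  obtain ⟨a, V, ha, hV₀, hV⟩ := exists_seq_of_forall_finset (γ := γ)
    (fun d => (Finset.range d.1).image d.2.2)
    (fun _ V d => 0 < d.1 ∧ (∀ i < d.1, d.2.1 i ∈ H ∧ d.2.2 i ∈ H) ∧
      (∀ i < d.1, ∀ j < d.1, d.2.1 i = d.2.1 j → i = j) ∧
      (∀ i < d.1, ∀ j < d.1, d.2.2 i = d.2.2 j → i = j) ∧
      (∀ i < d.1, ∀ j < d.1, blk (d.2.2 i) = blk (d.2.2 j)) ∧
      (∀ i < d.1, ∀ j < d.1, blk (d.2.1 i) < blk (d.2.2 j)) ∧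
      (∀ v ∈ V, ∀ i < d.1, blk v < blk (d.2.1 i)) ∧ P d.2.1 d.1)
    (fun _ V => by
      obtain ⟨κ, hκ, hinj, n, hn, hPn⟩ := hP (V.sup blk)
      obtain ⟨ρ, y, hy, hρ, hρi⟩ := hH.exists_block n ((Finset.range n).sup fun i => blk (κ i))
      refine ⟨(n, κ, ρ), hn, fun i hi => ⟨(hκ i).1, (hρ i hi).1⟩, fun i _ j _ h => hinj h, hρi,
        fun i hi j hj => by rw [(hρ i hi).2, (hρ j hj).2], fun i hi j hj => ?_,
        fun v hv i hi => ?_, hPn⟩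
      · rw [(hρ j hj).2]
        exact lt_of_le_of_lt
          (Finset.le_sup (f := fun i => blk (κ i)) (Finset.mem_range.2 hi)) hy
      · exact lt_of_le_of_lt (Finset.le_sup hv) (hκ i).2) {ρ₀ 0}
  refine ⟨fun x => (a x).1, fun x => (a x).2.1, fun x => (a x).2.2,
    ⟨fun x => (ha x).1, fun x i hi => ((ha x).2.1 i hi).1, fun x i hi => ((ha x).2.1 i hi).2,
      fun x => (ha x).2.2.1, fun x => (ha x).2.2.2.1, fun x => (ha x).2.2.2.2.1,
      fun x i hi => ?_, fun x => (ha x).2.2.2.2.2.1, fun x x' hx i hi j hj => ?_⟩,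
    fun x => (ha x).2.2.2.2.2.2.2⟩
  · have := (ha x).2.2.2.2.2.2.1 (ρ₀ 0) (hV₀ x (Finset.mem_singleton_self _)) i hi
    rw [(hρ₀ 0 one_pos).2] at this
    omega
  · exact (ha x').2.2.2.2.2.2.1 _
      (hV x x' hx (Finset.mem_image_of_mem _ (Finset.mem_range.2 hi))) j hj

/-- König's lemma: if every branch through finite sets has an initial segment with the property
`Q`, then the lengths of these segments can be bounded. -/
theorem exists_bound_of_forall_branch (n : ℕ → ℕ) (hn : ∀ x, 0 < n x) (Q : ℕ → (ℕ → ℕ) → Prop)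
    (hloc : ∀ m f g, (∀ x < m, f x = g x) → Q m f → Q m g)
    (h : ∀ f : ℕ → ℕ, (∀ x, f x < n x) → ∃ m, Q m f) :
    ∃ N, ∀ f : ℕ → ℕ, (∀ x < N, f x < n x) → ∃ m ≤ N, Q m f := by
  -- Each `U m` depends on finitely many coordinates, hence is open; the claim is compactness of the
  -- product of finite discrete spaces.
  let U : ℕ → Set (∀ x, Fin (n x)) := fun m => {f | Q m fun x => (f x : ℕ)}
  have hU : ∀ m, IsOpen (U m) := by
    intro m
    rw [isOpen_iff_mem_nhds]
    intro f hf
    have hopen : IsOpen (Set.pi (Finset.range m : Set ℕ) fun x => ({f x} : Set (Fin (n x)))) :=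
      isOpen_set_pi (Finset.finite_toSet _) fun _ _ => isOpen_discrete _
    refine Filter.mem_of_superset (hopen.mem_nhds fun x _ => rfl) fun g hg => ?_
    refine hloc m _ _ (fun x hx => ?_) hf
    have := hg x (Finset.mem_coe.2 (Finset.mem_range.2 hx))
    rw [Set.mem_singleton_iff.1 this]
  obtain ⟨T, hT⟩ := isCompact_univ.elim_finite_subcover U hU (fun f _ => by
    obtain ⟨m, hm⟩ := h (fun x => (f x : ℕ)) (fun x => (f x).2)
    exact Set.mem_iUnion.2 ⟨m, hm⟩)
  refine ⟨T.sup id, fun f hf => ?_⟩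
  let f' : ∀ x, Fin (n x) := fun x => if hx : x < T.sup id then ⟨f x, hf x hx⟩ else ⟨0, hn x⟩
  have hmem := hT (Set.mem_univ f')
  simp only [Set.mem_iUnion] at hmem
  obtain ⟨m, hm, hQ⟩ := hmem
  have hmT : m ≤ T.sup id := Finset.le_sup (f := id) hm
  refine ⟨m, hmT, hloc m _ _ (fun x hx => ?_) hQ⟩
  simp only [f']
  rw [dif_pos (lt_of_lt_of_le hx hmT)]

end Blocks

/-! ### Row systems yield separating configurations. -/

section Assembly

variable {𝕜 : Type v} [RCLike 𝕜] {X : Type u} [NormedAddCommGroup X] [NormedSpace 𝕜 X]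
  {α : Type*}

/-- On some combination over `E`, the layer `i` is `R` times larger than the other layers. -/
def IsSeparatedOn (𝕜 : Type v) {X : Type u} [RCLike 𝕜] [NormedAddCommGroup X] [NormedSpace 𝕜 X]
    {α : Type*} (x : α → X) (σ : Fin 3 → ℕ × ℕ → α) (w : Fin 3 → ℝ) (R : ℝ) (i : Fin 3)
    (E : Finset (ℕ × ℕ)) : Prop :=
  ∃ τ : ℕ × ℕ → 𝕜, R * ∑ j ∈ Finset.univ.erase i, w j * ‖∑ k ∈ E, τ k • x (σ j k)‖ <
    w i * ‖∑ k ∈ E, τ k • x (σ i k)‖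

/-- The index set of the first `N` rows of lengths `n`. -/
def rowIndex (n : ℕ → ℕ) (N : ℕ) : Finset (ℕ × ℕ) :=
  (Finset.range N).biUnion fun x => (Finset.range (n x)).map ⟨Prod.mk x, Prod.mk_right_injective x⟩

theorem mem_rowIndex {n : ℕ → ℕ} {N : ℕ} {q : ℕ × ℕ} :
    q ∈ rowIndex n N ↔ q.1 < N ∧ q.2 < n q.1 := by
  obtain ⟨x, i⟩ := q
  simp only [rowIndex, Finset.mem_biUnion, Finset.mem_range, Finset.mem_map,
    Function.Embedding.coeFn_mk, Prod.mk.injEq]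
  constructor
  · rintro ⟨y, hy, j, hj, rfl, rfl⟩
    exact ⟨hy, hj⟩
  · rintro ⟨hx, hi⟩
    exact ⟨x, hx, i, hi, rfl, rfl⟩

/-- The graph of `f` over the first `m` rows. -/
def graphIndex (f : ℕ → ℕ) (m : ℕ) : Finset (ℕ × ℕ) :=
  (Finset.range m).map ⟨fun x => (x, f x), fun _ _ h => (Prod.mk.inj h).1⟩

/-- For each colouring there are three cases: a point of colour `i₁`, a row entirely of colour `i₂`,
or, failing both, a point of colour `i₃` in every row. The three separation hypotheses answer these
cases. Disjointness of the triples comes from the order of the blocks. -/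
theorem hasSeparatingConfiguration_of_rows (x : α → X) (R : ℝ) (V : Finset α) {blk : α → ℕ}
    {H : Set α} {n : ℕ → ℕ} {D B : ℕ → ℕ → α} (hrow : IsRowSystem blk H (V.sup blk) n D B)
    (N : ℕ) (g : ℕ × ℕ → α)
    (hg : ∀ q ∈ rowIndex n N, ∀ q' ∈ rowIndex n N, g q = g q' → q = q')
    (hgB : ∀ q ∈ rowIndex n N, ∀ q' ∈ rowIndex n N, blk (B q.1 q.2) < blk (g q'))
    (w : Fin 3 → ℝ) (hw : ∀ i, 0 < w i) (i₁ i₂ i₃ : Fin 3) (hi : ∀ i, i = i₁ ∨ i = i₂ ∨ i = i₃)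
    (h₁ : ∀ q ∈ rowIndex n N, IsSeparatedOn 𝕜 x
      ![fun q => D q.1 q.2, fun q => B q.1 q.2, g] w R i₁ {q})
    (h₂ : ∀ y < N, IsSeparatedOn 𝕜 x ![fun q => D q.1 q.2, fun q => B q.1 q.2, g] w R i₂
      ((Finset.range (n y)).map ⟨Prod.mk y, Prod.mk_right_injective y⟩))
    (h₃ : ∀ f : ℕ → ℕ, (∀ y < N, f y < n y) → ∃ m ≤ N, IsSeparatedOn 𝕜 x
      ![fun q => D q.1 q.2, fun q => B q.1 q.2, g] w R i₃ (graphIndex f m)) :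
    HasSeparatingConfiguration 𝕜 x R V := by
  classical
  have hDB : ∀ q ∈ rowIndex n N, ∀ q' ∈ rowIndex n N, D q.1 q.2 ≠ B q'.1 q'.2 := by
    intro q hq q' hq' heq
    rw [mem_rowIndex] at hq hq'
    have hb := congrArg blk heq
    rcases lt_trichotomy q.1 q'.1 with h | h | h
    · have h1 := hrow.ltDB q.1 q.2 hq.2 q.2 hq.2
      have h2 := hrow.ltBD q.1 q'.1 h q.2 hq.2 q'.2 hq'.2
      have h3 := hrow.ltDB q'.1 q'.2 hq'.2 q'.2 hq'.2
      omega
    · have h1 := hrow.ltDB q.1 q.2 hq.2 q'.2 (h ▸ hq'.2)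
      rw [hb, h] at h1
      exact lt_irrefl _ h1
    · have h1 := hrow.ltBD q'.1 q.1 h q'.2 hq'.2 q.2 hq.2
      omega
  have hDg : ∀ q ∈ rowIndex n N, ∀ q' ∈ rowIndex n N, D q.1 q.2 ≠ g q' := by
    intro q hq q' hq' heq
    have h1 := hgB q hq q' hq'
    rw [mem_rowIndex] at hq
    have h2 := hrow.ltDB q.1 q.2 hq.2 q.2 hq.2
    have := congrArg blk heq
    omega
  have hBg : ∀ q ∈ rowIndex n N, ∀ q' ∈ rowIndex n N, B q.1 q.2 ≠ g q' := by
    intro q hq q' hq' heq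
    have h1 := hgB q hq q' hq'
    have := congrArg blk heq
    omega
  have hDD : ∀ q ∈ rowIndex n N, ∀ q' ∈ rowIndex n N, D q.1 q.2 = D q'.1 q'.2 → q = q' := by
    intro q hq q' hq' heq
    rw [mem_rowIndex] at hq hq'
    have hb := congrArg blk heq
    rcases lt_trichotomy q.1 q'.1 with h | h | h
    · have h1 := hrow.ltDB q.1 q.2 hq.2 q.2 hq.2
      have h2 := hrow.ltBD q.1 q'.1 h q.2 hq.2 q'.2 hq'.2
      omega
    · obtain ⟨y, i⟩ := q
      obtain ⟨y', j⟩ := q'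
      simp only at h
      subst h
      rw [hrow.injD y i hq.2 j hq'.2 heq]
    · have h1 := hrow.ltDB q'.1 q'.2 hq'.2 q'.2 hq'.2
      have h2 := hrow.ltBD q'.1 q.1 h q'.2 hq'.2 q.2 hq.2
      omega
  have hBB : ∀ q ∈ rowIndex n N, ∀ q' ∈ rowIndex n N, B q.1 q.2 = B q'.1 q'.2 → q = q' := by
    intro q hq q' hq' heq
    rw [mem_rowIndex] at hq hq'
    have hb := congrArg blk heq
    rcases lt_trichotomy q.1 q'.1 with h | h | h
    · have h1 := hrow.ltDB q'.1 q'.2 hq'.2 q'.2 hq'.2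
      have h2 := hrow.ltBD q.1 q'.1 h q.2 hq.2 q'.2 hq'.2
      omega
    · obtain ⟨y, i⟩ := q
      obtain ⟨y', j⟩ := q'
      simp only at h
      subst h
      rw [hrow.injB y i hq.2 j hq'.2 heq]
    · have h1 := hrow.ltDB q.1 q.2 hq.2 q.2 hq.2
      have h2 := hrow.ltBD q'.1 q.1 h q'.2 hq'.2 q.2 hq.2
      omega
  have hVlt : ∀ q ∈ rowIndex n N, ∀ a ∈ V, blk a < blk (D q.1 q.2) := by
    intro q hq a ha
    rw [mem_rowIndex] at hq
    exact lt_of_le_of_lt (Finset.le_sup ha) (hrow.beyond q.1 q.2 hq.2)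
  have hVltB : ∀ q ∈ rowIndex n N, ∀ a ∈ V, blk a < blk (B q.1 q.2) := by
    intro q hq a ha
    have := hVlt q hq a ha
    rw [mem_rowIndex] at hq
    exact this.trans (hrow.ltDB q.1 q.2 hq.2 q.2 hq.2)
  refine ⟨rowIndex n N, ![fun q => D q.1 q.2, fun q => B q.1 q.2, g], w, hw, ?_, ?_, fun c => ?_⟩
  · intro i j q hq q' hq' heq
    fin_cases i <;> fin_cases j <;> simp at heq ⊢
    · exact hDD q hq q' hq' heq
    · exact hDB q hq q' hq' heq
    · exact hDg q hq q' hq' heq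
    · exact hDB q' hq' q hq heq.symm
    · exact hBB q hq q' hq' heq
    · exact hBg q hq q' hq' heq
    · exact hDg q' hq' q hq heq.symm
    · exact hBg q' hq' q hq heq.symm
    · exact hg q hq q' hq' heq
  · intro i q hq hV
    fin_cases i <;> simp at hV
    · exact lt_irrefl _ (hVlt q hq _ hV)
    · exact lt_irrefl _ (hVltB q hq _ hV)
    · exact lt_irrefl _ ((hVltB q hq _ hV).trans (hgB q hq q hq))
  · by_cases hc1 : ∃ q ∈ rowIndex n N, c q = i₁
    · obtain ⟨q, hq, hcq⟩ := hc1
      refine ⟨i₁, {q}, Finset.singleton_subset_iff.2 hq, fun k hk => ?_, h₁ q hq⟩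
      rw [Finset.mem_singleton.1 hk, hcq]
    · push Not at hc1
      by_cases hc2 : ∃ y < N, ∀ i < n y, c (y, i) = i₂
      · obtain ⟨y, hy, hcy⟩ := hc2
        refine ⟨i₂, _, fun k hk => ?_, fun k hk => ?_, h₂ y hy⟩
        · obtain ⟨i, hi, rfl⟩ := Finset.mem_map.1 hk
          exact mem_rowIndex.2 ⟨hy, Finset.mem_range.1 hi⟩
        · obtain ⟨i, hi, rfl⟩ := Finset.mem_map.1 hk
          exact hcy i (Finset.mem_range.1 hi)
      · push Not at hc2
        have hex : ∀ y, ∃ i, y < N → i < n y ∧ c (y, i) ≠ i₂ := by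
          intro y
          by_cases hy : y < N
          · obtain ⟨i, h1, h2⟩ := hc2 y hy
            exact ⟨i, fun _ => ⟨h1, h2⟩⟩
          · exact ⟨0, fun h => absurd h hy⟩
        choose f hf using hex
        obtain ⟨m, hm, hsep⟩ := h₃ f fun y hy => (hf y hy).1
        refine ⟨i₃, _, fun k hk => ?_, fun k hk => ?_, hsep⟩
        · obtain ⟨y, hy, rfl⟩ := Finset.mem_map.1 hk
          have hyN := lt_of_lt_of_le (Finset.mem_range.1 hy) hm
          exact mem_rowIndex.2 ⟨hyN, (hf y hyN).1⟩
        · obtain ⟨y, hy, rfl⟩ := Finset.mem_map.1 hk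
          have hyN := lt_of_lt_of_le (Finset.mem_range.1 hy) hm
          have h1 := hc1 (y, f y) (mem_rowIndex.2 ⟨hyN, (hf y hyN).1⟩)
          rcases hi (c (y, f y)) with h | h | h
          · exact absurd h h1
          · exact absurd h (hf y hyN).2
          · exact h

end Assembly

/-! ### Separation when neither single vectors nor pair sums dominate `l_p`. -/

section BlockFamilies

variable {𝕜 : Type v} [RCLike 𝕜] {X : Type u} [NormedAddCommGroup X] [NormedSpace 𝕜 X]
  {α : Type*}

/-- A family indexed by blocks such that the blocks are uniformly equivalent to unit vector bases
of finite-dimensional `l_p` spaces. -/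
def IsBlockFamily (𝕜 : Type v) {X : Type u} [RCLike 𝕜] [NormedAddCommGroup X] [NormedSpace 𝕜 X]
    {α : Type*} (p c : ℝ) (blk : α → ℕ) (x : α → X) : Prop :=
  ∀ E : Finset α, (∀ a ∈ E, ∀ b ∈ E, blk a = blk b) → ∀ t : α → 𝕜,
    c⁻¹ * finLpNorm p E t ≤ ‖∑ a ∈ E, t a • x a‖ ∧ ‖∑ a ∈ E, t a • x a‖ ≤ c * finLpNorm p E t

theorem IsBlockFamily.comp {p c : ℝ} {blk : α → ℕ} {x : α → X} (h : IsBlockFamily 𝕜 p c blk x)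
    {κ : Type*} (E : Finset κ) (ρ : κ → α) (hρ : ∀ k ∈ E, ∀ l ∈ E, ρ k = ρ l → k = l)
    (hblk : ∀ k ∈ E, ∀ l ∈ E, blk (ρ k) = blk (ρ l)) (t : κ → 𝕜) :
    c⁻¹ * finLpNorm p E t ≤ ‖∑ k ∈ E, t k • x (ρ k)‖ ∧
      ‖∑ k ∈ E, t k • x (ρ k)‖ ≤ c * finLpNorm p E t := by
  classical
  by_cases hE : E.Nonempty
  swap
  · rw [Finset.not_nonempty_iff_eq_empty] at hE
    subst hE
    have := h ∅ (by simp) 0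
    simpa [finLpNorm] using this
  have : Nonempty κ := ⟨hE.choose⟩
  have hinj : Set.InjOn ρ E := fun k hk l hl => hρ k hk l hl
  let t' : α → 𝕜 := fun a => t (Function.invFunOn ρ E a)
  have ht' : ∀ k ∈ E, t' (ρ k) = t k := fun k hk => by
    simp only [t']
    rw [hinj.leftInvOn_invFunOn hk]
  have h1 := h (E.image ρ) (by
    intro a ha b hb
    obtain ⟨k, hk, rfl⟩ := Finset.mem_image.1 ha
    obtain ⟨l, hl, rfl⟩ := Finset.mem_image.1 hb
    exact hblk k hk l hl) t'
  rw [finLpNorm_image p hinj, Finset.sum_image hinj, finLpNorm_congr ht',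
    Finset.sum_congr rfl fun k hk => by rw [ht' k hk]] at h1
  exact h1

theorem IsBlockFamily.norm_le {p c : ℝ} (hp : 1 ≤ p) {blk : α → ℕ} {x : α → X}
    (h : IsBlockFamily 𝕜 p c blk x) (a : α) : c⁻¹ ≤ ‖x a‖ ∧ ‖x a‖ ≤ c := by
  have := h {a} (by simp) (fun _ => (1 : 𝕜))
  rw [finLpNorm_singleton hp] at this
  simpa using this

theorem HasSeparatingConfiguration.mono {x : α → X} {R R' : ℝ} {V : Finset α} (hR : R ≤ R')
    (h : HasSeparatingConfiguration 𝕜 x R' V) : HasSeparatingConfiguration 𝕜 x R V := by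
  obtain ⟨K, σ, w, hw, h1, h2, h3⟩ := h
  refine ⟨K, σ, w, hw, h1, h2, fun c => ?_⟩
  obtain ⟨i, E, hE, hEc, τ, hτ⟩ := h3 c
  refine ⟨i, E, hE, hEc, τ, lt_of_le_of_lt (mul_le_mul_of_nonneg_right hR ?_) hτ⟩
  exact Finset.sum_nonneg fun j _ => mul_nonneg (hw j).le (norm_nonneg _)

theorem IsLargeSet.exists_last_block {blk : α → ℕ} {H : Set α} (hH : IsLargeSet blk H)
    (K : Finset (ℕ × ℕ)) (B : ℕ × ℕ → α) :
    ∃ g : ℕ × ℕ → α, (∀ q ∈ K, ∀ q' ∈ K, g q = g q' → q = q') ∧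
      (∀ q ∈ K, ∀ q' ∈ K, blk (B q) < blk (g q')) ∧
      ∀ q ∈ K, ∀ q' ∈ K, blk (g q) = blk (g q') := by
  -- The pairing function places `K` inside an initial segment of `ℕ`, so one sufficiently large
  -- block holds all of it.
  obtain ⟨ρ, y, hy, hρ, hinj⟩ := hH.exists_block (K.sup (fun q => Nat.pair q.1 q.2) + 1)
    (K.sup fun q => blk (B q))
  have hlt : ∀ q ∈ K, Nat.pair q.1 q.2 < K.sup (fun q => Nat.pair q.1 q.2) + 1 := fun q hq =>
    Nat.lt_succ_of_le (Finset.le_sup (f := fun q : ℕ × ℕ => Nat.pair q.1 q.2) hq)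
  refine ⟨fun q => ρ (Nat.pair q.1 q.2), fun q hq q' hq' h => ?_, fun q hq q' hq' => ?_,
    fun q hq q' hq' => ?_⟩
  · have := Nat.pair_eq_pair.1 (hinj _ (hlt q hq) _ (hlt q' hq') h)
    exact Prod.ext this.1 this.2
  · rw [(hρ _ (hlt q' hq')).2]
    exact lt_of_le_of_lt (Finset.le_sup (f := fun q => blk (B q)) hq) hy
  · rw [(hρ _ (hlt q hq)).2, (hρ _ (hlt q' hq')).2]

theorem sum_erase_fin_three (F : Fin 3 → ℝ) (i : Fin 3) :
    ∑ j ∈ Finset.univ.erase i, F j = F 0 + F 1 + F 2 - F i := by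
  rw [Finset.sum_erase_eq_sub (Finset.mem_univ i), Fin.sum_univ_three]

/-- Coefficients on a finite set can be extended to an initial segment. -/
theorem exists_initial_segment {p : ℝ} (hp : 1 ≤ p) (y : ℕ → X) (s : Finset ℕ) (t : ℕ → 𝕜) :
    ∃ n, 0 < n ∧ ∃ t' : ℕ → 𝕜, finLpNorm p (Finset.range n) t' = finLpNorm p s t ∧
      ∑ i ∈ Finset.range n, t' i • y i = ∑ i ∈ s, t i • y i := by
  have h : s ⊆ Finset.range (s.sup id + 1) := fun i hi =>
    Finset.mem_range.2 (Nat.lt_succ_of_le (Finset.le_sup (f := id) hi))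
  exact ⟨s.sup id + 1, Nat.succ_pos _, fun i => if i ∈ s then t i else 0, finLpNorm_ite hp h t,
    sum_ite_smul_of_subset h t y⟩

theorem IsRowSystem.injective_elim {blk : α → ℕ} {H : Set α} {m : ℕ} {n : ℕ → ℕ}
    {D B : ℕ → ℕ → α} (hrow : IsRowSystem blk H m n D B) {f : ℕ → ℕ} (hf : ∀ y, f y < n y) :
    Function.Injective (Sum.elim (fun y => D y (f y)) fun y => B y (f y)) := by
  have hlt : ∀ y, blk (D y (f y)) < blk (B y (f y)) := fun y => hrow.ltDB y _ (hf y) _ (hf y)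
  have hBD : ∀ y y', y < y' → blk (B y (f y)) < blk (D y' (f y')) := fun y y' h =>
    hrow.ltBD y y' h _ (hf y) _ (hf y')
  have hDm : StrictMono fun y => blk (D y (f y)) := fun y y' h => (hlt y).trans (hBD y y' h)
  have hBm : StrictMono fun y => blk (B y (f y)) := fun y y' h => (hBD y y' h).trans (hlt y')
  refine Function.Injective.sumElim (fun y y' h => hDm.injective (congrArg blk h))
    (fun y y' h => hBm.injective (congrArg blk h)) fun y y' h => ?_
  have hb := congrArg blk h
  rcases lt_or_ge y' y with h' | h'
  · exact absurd (hBD y' y h') (by omega)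
  · have h1 := hlt y
    have h2 : blk (B y (f y)) ≤ blk (B y' (f y')) := hBm.monotone h'
    omega

theorem IsUnconditionalWith.norm_sum_le_norm_sum_add {x : α → X}
    (hx : IsUnconditionalWith 𝕜 1 x) {κ κ' : ℕ → α}
    (hinj : Function.Injective (Sum.elim κ κ')) (s : Finset ℕ) (t : ℕ → 𝕜) :
    ‖∑ i ∈ s, t i • x (κ i)‖ ≤ ‖∑ i ∈ s, t i • (x (κ i) + x (κ' i))‖ ∧
      ‖∑ i ∈ s, t i • x (κ' i)‖ ≤ ‖∑ i ∈ s, t i • (x (κ i) + x (κ' i))‖ := by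
  have h := hx.comp_injective hinj
  have hsum : ∑ i ∈ s, t i • (x (κ i) + x (κ' i)) =
      ∑ q ∈ s.disjSum s, Sum.elim t t q • x (Sum.elim κ κ' q) := by
    rw [Finset.sum_disjSum, ← Finset.sum_add_distrib]
    exact Finset.sum_congr rfl fun i _ => smul_add _ _ _
  have h1 := h.norm_sum_subset_le
    (Finset.disjSum_mono subset_rfl (Finset.empty_subset s) : s.disjSum ∅ ⊆ s.disjSum s)
    (Sum.elim t t)
  have h2 := h.norm_sum_subset_le
    (Finset.disjSum_mono (Finset.empty_subset s) subset_rfl : Finset.disjSum ∅ s ⊆ s.disjSum s)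
    (Sum.elim t t)
  rw [← hsum, Finset.sum_disjSum] at h1 h2
  simp only [Finset.sum_empty, add_zero, zero_add, Sum.elim_inl, Sum.elim_inr] at h1 h2
  exact ⟨h1, h2⟩

theorem sum_graphIndex {M : Type*} [AddCommMonoid M] (f : ℕ → ℕ) (m : ℕ) (F : ℕ × ℕ → M) :
    ∑ q ∈ graphIndex f m, F q = ∑ y ∈ Finset.range m, F (y, f y) :=
  Finset.sum_map _ _ _

/-- Separating configurations in families no pair sums of which dominate `l_p`. -/
theorem hasSeparatingConfiguration_of_not_dominates {p c : ℝ} (hp : 1 ≤ p) (hc : 1 ≤ c)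
    {blk : α → ℕ} {x : α → X} (hx : IsUnconditionalWith 𝕜 1 x)
    (hB : IsBlockFamily 𝕜 p c blk x) (hlarge : IsLargeSet blk Set.univ)
    (hsingle : ∀ κ : ℕ → α, Function.Injective κ → ∀ C : ℝ, ∃ (s : Finset ℕ) (t : ℕ → 𝕜),
      C * ‖∑ i ∈ s, t i • x (κ i)‖ < finLpNorm p s t)
    (hpair : ∀ κ κ' : ℕ → α, Function.Injective (Sum.elim κ κ') →
      ∀ C : ℝ, ∃ (s : Finset ℕ) (t : ℕ → 𝕜),
        C * ‖∑ i ∈ s, t i • (x (κ i) + x (κ' i))‖ < finLpNorm p s t)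
    (R : ℝ) (V : Finset α) : HasSeparatingConfiguration 𝕜 x R V := by
  refine HasSeparatingConfiguration.mono (le_max_left R 1) ?_
  set S := max R 1
  have hS : 1 ≤ S := le_max_right _ _
  have hc0 : 0 < c := by linarith
  have hS0 : 0 < S := by linarith
  -- The constants are tuned so that in each of the three cases `S` times the bound for the two
  -- competing layers is half the lower bound for the main layer: `D` on points, `B` on rows, `g` on
  -- branches.
  set w₁ : ℝ := 1 / (4 * S * c ^ 2) with hw₁
  set w₂ : ℝ := w₁ / (4 * S * c ^ 2) with hw₂
  set η : ℝ := w₁ / (4 * S * c) with hη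
  set η' : ℝ := w₂ / (4 * S * c) with hη'
  have hw₁0 : 0 < w₁ := by positivity
  have hw₂0 : 0 < w₂ := by positivity
  have hη0 : 0 < η := by positivity
  have hη'0 : 0 < η' := by positivity
  have hc2 : 1 ≤ c ^ 2 := one_le_pow₀ hc
  have h4 : 1 ≤ 4 * S * c ^ 2 := by nlinarith
  have hw₁1 : w₁ ≤ 1 := by rw [hw₁]; exact div_le_one_of_le₀ h4 (by positivity)
  have hw₂₁ : w₂ ≤ w₁ := div_le_self hw₁0.le h4
  obtain ⟨n, D, B, hrow, hP⟩ := exists_rowSystem hlarge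
    (fun κ n => ∃ t : ℕ → 𝕜, ‖∑ i ∈ Finset.range n, t i • x (κ i)‖ <
      η * finLpNorm p (Finset.range n) t) (fun m => by
      obtain ⟨κ, hκ⟩ := hlarge.exists_transversal m
      obtain ⟨s, t, hst⟩ := hsingle κ hκ.injective (1 / η)
      obtain ⟨n, hn, t', h1, h2⟩ := exists_initial_segment hp (fun i => x (κ i)) s t
      refine ⟨κ, fun i => ⟨hκ.1 i, hκ.2.1 i⟩, hκ.injective, n, hn, t', ?_⟩
      rw [h1, h2]
      rwa [one_div, inv_mul_lt_iff₀ hη0] at hst) (V.sup blk)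
  -- Along an infinite branch the pair sums of `D` and `B` fail to dominate `l_p`, and a finite
  -- initial segment already shows it.
  obtain ⟨N, hN⟩ := exists_bound_of_forall_branch n hrow.pos
    (fun m f => ∃ t : ℕ → 𝕜, ‖∑ y ∈ Finset.range m, t y • (x (D y (f y)) + x (B y (f y)))‖ <
      η' * finLpNorm p (Finset.range m) t)
    (fun m f g hfg ⟨t, ht⟩ => ⟨t, by
      rwa [Finset.sum_congr rfl fun y hy => by rw [← hfg y (Finset.mem_range.1 hy)]]⟩)
    (fun f hf => by
      obtain ⟨s, t, hst⟩ := hpair _ _ (hrow.injective_elim hf) (1 / η')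
      obtain ⟨m, _, t', h1, h2⟩ :=
        exists_initial_segment hp (fun y => x (D y (f y)) + x (B y (f y))) s t
      refine ⟨m, t', ?_⟩
      rw [h1, h2]
      rwa [one_div, inv_mul_lt_iff₀ hη'0] at hst)
  obtain ⟨g, hg, hgB, hgblk⟩ := hlarge.exists_last_block (rowIndex n N) fun q => B q.1 q.2
  refine hasSeparatingConfiguration_of_rows x S V hrow N g hg hgB ![1, w₁, w₂] ?_ 0 1 2
    (fun i => by fin_cases i <;> simp) ?_ ?_ ?_
  · intro i
    fin_cases i <;> simp [hw₁0, hw₂0]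
  · intro q _
    refine ⟨fun _ => 1, ?_⟩
    rw [sum_erase_fin_three]
    simp
    have hD := (hB.norm_le hp (D q.1 q.2)).1
    have hBn := mul_le_mul_of_nonneg_left (hB.norm_le hp (B q.1 q.2)).2 hw₁0.le
    have hG := mul_le_mul_of_nonneg_left (hB.norm_le hp (g q)).2 hw₂0.le
    have h1 := mul_le_mul_of_nonneg_right hw₂₁ hc0.le
    have h2 : S * (w₁ * c + w₁ * c) = c⁻¹ / 2 := by
      rw [hw₁]; field_simp; norm_num
    have h3 : 0 < c⁻¹ := inv_pos.2 hc0
    have h4 := mul_le_mul_of_nonneg_left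
      (by linarith : w₁ * ‖x (B q.1 q.2)‖ + w₂ * ‖x (g q)‖ ≤ w₁ * c + w₁ * c) hS0.le
    linarith
  · intro y hy
    obtain ⟨t, ht⟩ := hP y
    refine ⟨fun q => t q.2, ?_⟩
    rw [sum_erase_fin_three]
    simp only [Finset.sum_map, Function.Embedding.coeFn_mk]
    simp
    have hidx : ∀ i ∈ Finset.range (n y), (y, i) ∈ rowIndex n N := fun i hi =>
      mem_rowIndex.2 ⟨hy, Finset.mem_range.1 hi⟩
    have hBn := (hB.comp (Finset.range (n y)) (fun i => B y i)
      (fun i hi j hj => hrow.injB y i (Finset.mem_range.1 hi) j (Finset.mem_range.1 hj))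
      (fun i hi j hj => hrow.blkB y i (Finset.mem_range.1 hi) j (Finset.mem_range.1 hj)) t).1
    have hG := (hB.comp (Finset.range (n y)) (fun i => g (y, i))
      (fun i hi j hj h => (Prod.mk.inj (hg _ (hidx i hi) _ (hidx j hj) h)).2)
      (fun i hi j hj => hgblk _ (hidx i hi) _ (hidx j hj)) t).2
    have hL : 0 < finLpNorm p (Finset.range (n y)) t := by
      by_contra hcon
      have := lt_of_le_of_lt (norm_nonneg _) ht
      nlinarith
    set Lp := finLpNorm p (Finset.range (n y)) t
    have h1 : S * (η * Lp + w₂ * (c * Lp)) = w₁ * (c⁻¹ * Lp) / 2 := by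
      rw [hη, hw₂]; field_simp; norm_num
    have h2 : 0 < w₁ * (c⁻¹ * Lp) := by positivity
    have h3 := mul_le_mul_of_nonneg_left hBn hw₁0.le
    have h4 := mul_le_mul_of_nonneg_left hG hw₂0.le
    have h5 := mul_le_mul_of_nonneg_left (add_le_add ht.le h4) hS0.le
    linarith
  · intro f hf
    obtain ⟨m, hm, t, ht⟩ := hN f hf
    refine ⟨m, hm, fun q => t q.1, ?_⟩
    rw [sum_erase_fin_three]
    simp only [sum_graphIndex]
    simp
    have hlt : ∀ y ∈ Finset.range m, y < N := fun y hy =>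
      lt_of_lt_of_le (Finset.mem_range.1 hy) hm
    have hidx : ∀ y ∈ Finset.range m, (y, f y) ∈ rowIndex n N := fun y hy =>
      mem_rowIndex.2 ⟨hlt y hy, hf y (hlt y hy)⟩
    have hG := (hB.comp (Finset.range m) (fun y => g (y, f y))
      (fun y hy y' hy' h => (Prod.mk.inj (hg _ (hidx y hy) _ (hidx y' hy') h)).1)
      (fun y hy y' hy' => hgblk _ (hidx y hy) _ (hidx y' hy')) t).1
    -- The branch is controlled only on the first `N` rows; beyond them any admissible value will
    -- do, and `0` is one since rows are nonempty.
    let f' : ℕ → ℕ := fun y => if y < N then f y else 0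
    have hf' : ∀ y, f' y < n y := fun y => by
      simp only [f']
      split_ifs with h
      · exact hf y h
      · exact hrow.pos y
    obtain ⟨hD, hBn⟩ := hx.norm_sum_le_norm_sum_add (hrow.injective_elim hf') (Finset.range m) t
    have hff : ∀ y ∈ Finset.range m, f' y = f y := fun y hy => if_pos (hlt y hy)
    have e₁ : ∑ y ∈ Finset.range m, t y • x (D y (f' y)) =
        ∑ y ∈ Finset.range m, t y • x (D y (f y)) :=
      Finset.sum_congr rfl fun y hy => by rw [hff y hy]
    have e₂ : ∑ y ∈ Finset.range m, t y • x (B y (f' y)) =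
        ∑ y ∈ Finset.range m, t y • x (B y (f y)) :=
      Finset.sum_congr rfl fun y hy => by rw [hff y hy]
    have e₃ : ∑ y ∈ Finset.range m, t y • (x (D y (f' y)) + x (B y (f' y))) =
        ∑ y ∈ Finset.range m, t y • (x (D y (f y)) + x (B y (f y))) :=
      Finset.sum_congr rfl fun y hy => by rw [hff y hy]
    rw [e₁, e₃] at hD
    rw [e₂, e₃] at hBn
    have hL : 0 < finLpNorm p (Finset.range m) t := by
      by_contra hcon
      have := lt_of_le_of_lt (norm_nonneg _) ht
      nlinarith
    set Lp := finLpNorm p (Finset.range m) t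
    have h1 : S * (η' * Lp + η' * Lp) = w₂ * (c⁻¹ * Lp) / 2 := by
      rw [hη']; field_simp; norm_num
    have h2 : 0 < w₂ * (c⁻¹ * Lp) := by positivity
    have h3 := mul_le_mul_of_nonneg_left hG hw₂0.le
    have h4 := mul_le_of_le_one_left (norm_nonneg
      (∑ y ∈ Finset.range m, t y • x (B y (f y)))) hw₁1
    have h5 := mul_le_mul_of_nonneg_left
      (add_le_add (hD.trans ht.le) (h4.trans (hBn.trans ht.le))) hS0.le
    linarith

end BlockFamilies

/-! ### A Nash-Williams theorem for transversals of large sets. -/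

section Ramsey

variable {α : Type*}

/-- The sequence `κ` preceded by `a`. -/
def seqCons (a : α) (κ : ℕ → α) : ℕ → α := fun j => Nat.casesOn j a κ

theorem seqCons_head_tail (κ : ℕ → α) : seqCons (κ 0) (fun j => κ (j + 1)) = κ := by
  funext j
  cases j <;> rfl

/-- Every large set has a large subset whose transversals beyond `y` all have the property `G` or
all fail to have it. -/
def IsRamseyBeyond (blk : α → ℕ) (G : (ℕ → α) → Prop) (y : ℕ) : Prop :=
  ∀ H : Set α, IsLargeSet blk H → ∃ H' ⊆ H, IsLargeSet blk H' ∧ ∃ b : Bool,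
    ∀ κ, IsTransversal blk H' y κ → (G κ ↔ b = true)

theorem IsTransversal.mono {blk : α → ℕ} {H H' : Set α} {m : ℕ} {κ : ℕ → α}
    (h : IsTransversal blk H m κ) (hH : H ⊆ H') : IsTransversal blk H' m κ :=
  ⟨fun j => hH (h.1 j), h.2⟩

/-- The Ramsey property is applied to the elements of `A` in turn. Earlier decisions survive, as a
transversal of a smaller set is one of the larger set. -/
theorem exists_large_forall_mem {blk : α → ℕ} {G : (ℕ → α) → Prop} {H : Set α}
    (hH : IsLargeSet blk H) (A : Finset α)
    (hA : ∀ a ∈ A, IsRamseyBeyond blk (fun κ => G (seqCons a κ)) (blk a)) :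
    ∃ H' ⊆ H, IsLargeSet blk H' ∧ ∀ a ∈ A, ∃ b : Bool,
      ∀ κ, IsTransversal blk H' (blk a) κ → (G (seqCons a κ) ↔ b = true) := by
  classical
  induction A using Finset.induction_on with
  | empty => exact ⟨H, subset_rfl, hH, by simp⟩
  | insert a A _ ih =>
    obtain ⟨H₁, h₁, hl₁, hc₁⟩ := ih fun a' ha' => hA a' (Finset.mem_insert_of_mem ha')
    obtain ⟨H₂, h₂, hl₂, b, hb⟩ := hA a (Finset.mem_insert_self _ _) H₁ hl₁
    refine ⟨H₂, h₂.trans h₁, hl₂, fun a' ha' => ?_⟩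
    rcases Finset.mem_insert.1 ha' with rfl | ha'
    · exact ⟨b, hb⟩
    · obtain ⟨b', hb'⟩ := hc₁ a' ha'
      exact ⟨b', fun κ hκ => hb' κ (hκ.mono h₂)⟩

theorem exists_monochromatic_block {blk : α → ℕ} {G : (ℕ → α) → Prop} {y : ℕ}
    (hG : ∀ a, y < blk a → IsRamseyBeyond blk (fun κ => G (seqCons a κ)) (blk a))
    {H : Set α} (hH : IsLargeSet blk H) (m n : ℕ) :
    ∃ (A : Finset α) (H' : Set α) (z : ℕ) (b : Bool), (A : Set α) ⊆ H ∧ n ≤ A.card ∧ n ≤ z ∧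
      m < z ∧ (∀ a ∈ A, blk a = z) ∧ H' ⊆ H ∧ IsLargeSet blk H' ∧
      ∀ a ∈ A, ∀ κ, IsTransversal blk H' (blk a) κ → (G (seqCons a κ) ↔ b = true) := by
  classical
  -- Of `2 * n` elements at least `n` receive the same colour; the other summands push the block
  -- beyond `m` and `y`.
  obtain ⟨A, hAH, hAc, z, hz, hAz⟩ := hH (2 * n + m + y + 1)
  obtain ⟨H', hH', hl, hc⟩ := exists_large_forall_mem hH A fun a ha =>
    hG a (by rw [hAz a ha]; omega)
  choose! c hc using hc
  have hcard := Finset.card_filter_add_card_filter_not (s := A) (fun a => c a = true)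
  by_cases hn : n ≤ (A.filter fun a => c a = true).card
  · refine ⟨A.filter fun a => c a = true, H', z, true, ?_, hn, by omega, by omega,
      fun a ha => hAz a (Finset.mem_filter.1 ha).1, hH', hl, fun a ha κ hκ => ?_⟩
    · exact fun a ha => hAH (Finset.mem_filter.1 ha).1
    · exact (hc a (Finset.mem_filter.1 ha).1 κ hκ).trans (by simp [(Finset.mem_filter.1 ha).2])
  · refine ⟨A.filter fun a => ¬ c a = true, H', z, false, ?_, by omega, by omega, by omega,
      fun a ha => hAz a (Finset.mem_filter.1 ha).1, hH', hl, fun a ha κ hκ => ?_⟩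
    · exact fun a ha => hAH (Finset.mem_filter.1 ha).1
    · exact (hc a (Finset.mem_filter.1 ha).1 κ hκ).trans
        (by simp [Bool.eq_false_of_not_eq_true (Finset.mem_filter.1 ha).2])

/-- Fusion: the Ramsey property follows from the Ramsey properties after every first element. -/
theorem IsRamseyBeyond.of_seqCons {blk : α → ℕ} {G : (ℕ → α) → Prop} {y : ℕ}
    (hG : ∀ a, y < blk a → IsRamseyBeyond blk (fun κ => G (seqCons a κ)) (blk a)) :
    IsRamseyBeyond blk G y := by
  intro H hH
  choose A H' z b hAH hAc hnz hmz hAz hH' hl hc using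
    fun (S : {S : Set α // IsLargeSet blk S}) (m n : ℕ) => exists_monochromatic_block hG S.2 m n
  -- The state is the current large set and the last block used. Each stage keeps a monochromatic
  -- part of a block and shrinks the set so that every continuation respects its colour.
  let st : ℕ → {S : Set α // IsLargeSet blk S} × ℕ := fun n =>
    Nat.rec (⟨H, hH⟩, 0) (fun n s => (⟨H' s.1 s.2 n, hl _ _ _⟩, z s.1 s.2 n)) n
  have hst : ∀ n, st (n + 1) =
      (⟨H' (st n).1 (st n).2 n, hl _ _ _⟩, z (st n).1 (st n).2 n) := fun _ => rfl
  let A' : ℕ → Finset α := fun n => A (st n).1 (st n).2 n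
  let c : ℕ → Bool := fun n => b (st n).1 (st n).2 n
  have hanti : Antitone fun n => ((st n).1 : Set α) := antitone_nat_of_succ_le fun n => by
    rw [hst]; exact hH' _ _ _
  have hmono : StrictMono fun n => (st n).2 := strictMono_nat_of_lt_succ fun n => by
    rw [hst]; exact hmz _ _ _
  have hblk : ∀ n, ∀ a ∈ A' n, blk a = (st (n + 1)).2 := fun n a ha => hAz _ _ _ a ha
  -- One colour occurs at infinitely many stages. Their blocks still form a large set, and a
  -- transversal of it is decided by its first element, its tail lying in the set left by that
  -- stage.
  obtain ⟨col, hcol⟩ : ∃ col : Bool, ∃ᶠ n in atTop, c n = col := by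
    by_contra! h
    obtain ⟨n, h1, h2⟩ := ((h true).and (h false)).exists
    cases hn : c n
    · exact h2 hn
    · exact h1 hn
  refine ⟨{a | ∃ n, c n = col ∧ a ∈ A' n}, ?_, fun n => ?_, col, fun κ hκ => ?_⟩
  · rintro a ⟨n, -, ha⟩
    exact hanti (Nat.zero_le n) (hAH _ _ _ ha)
  · obtain ⟨k, hk, hkc⟩ := (Filter.frequently_atTop.1 hcol) n
    exact ⟨A' k, fun a ha => ⟨k, hkc, ha⟩, hk.trans (hAc _ _ _), (st (k + 1)).2,
      hk.trans (hnz _ _ _), hblk k⟩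
  · choose i hi hiA using hκ.1
    have him : ∀ j j', j < j' → i j < i j' := fun j j' h => by
      have := hκ.2.2 h
      simp only at this
      rw [hblk _ _ (hiA j), hblk _ _ (hiA j')] at this
      have := (hmono.lt_iff_lt (a := i j + 1) (b := i j' + 1)).1 this
      omega
    have := hc (st (i 0)).1 (st (i 0)).2 (i 0) (κ 0) (hiA 0) (fun j => κ (j + 1)) ⟨fun j => ?_,
      fun j => hκ.2.2 (Nat.succ_pos j), fun j j' h => hκ.2.2 (Nat.succ_lt_succ h)⟩
    · rw [seqCons_head_tail] at this
      rw [this]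
      exact (hi 0) ▸ Iff.rfl
    · have h1 : κ (j + 1) ∈ ((st (i (j + 1))).1 : Set α) := hAH _ _ _ (hiA (j + 1))
      exact hanti (him 0 (j + 1) (Nat.succ_pos j)) h1

/-- Nash-Williams' theorem for properties of transversals that are decided by finitely many
terms. -/
theorem isRamseyBeyond_of_locally_determined {blk : α → ℕ} {G : (ℕ → α) → Prop}
    (hloc : ∀ κ : ℕ → α, StrictMono (fun j => blk (κ j)) → ∃ n, ∀ κ' : ℕ → α,
      StrictMono (fun j => blk (κ' j)) → (∀ j < n, κ' j = κ j) → (G κ' ↔ G κ)) :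
    IsRamseyBeyond blk G 0 := by
  by_contra hcon
  -- By fusion, a failure of the Ramsey property persists after some first element. Iterating gives
  -- a sequence `κ₀` with failure after every initial segment, whereas finitely many terms of `κ₀`
  -- already decide `G`.
  have hstep : ∀ q : {q : ((ℕ → α) → Prop) × ℕ // ¬ IsRamseyBeyond blk q.1 q.2},
      ∃ a, q.1.2 < blk a ∧ ¬ IsRamseyBeyond blk (fun κ => q.1.1 (seqCons a κ)) (blk a) := by
    intro q
    by_contra! h
    exact q.2 (IsRamseyBeyond.of_seqCons h)
  choose a ha haR using hstep
  let st : ℕ → {q : ((ℕ → α) → Prop) × ℕ // ¬ IsRamseyBeyond blk q.1 q.2} := fun n =>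
    Nat.rec ⟨(G, 0), hcon⟩ (fun _ q => ⟨(fun κ => q.1.1 (seqCons (a q) κ), blk (a q)), haR q⟩) n
  let κ₀ : ℕ → α := fun n => a (st n)
  have hmono : StrictMono fun j => blk (κ₀ j) := strictMono_nat_of_lt_succ fun n => ha (st (n + 1))
  have hst : ∀ n κ, (st n).1.1 κ ↔ G (fun j => if j < n then κ₀ j else κ (j - n)) := by
    intro n
    induction n with
    | zero => intro κ; simp [st]
    | succ n ih =>
      intro κ
      change (st n).1.1 (seqCons (κ₀ n) κ) ↔ _
      rw [ih]
      refine iff_of_eq (congrArg G (funext fun j => ?_))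
      rcases lt_trichotomy j n with h | h | h
      · rw [if_pos h, if_pos (by omega)]
      · subst h
        simp [seqCons]
      · rw [if_neg (by omega), if_neg (by omega)]
        obtain ⟨k, rfl⟩ := Nat.exists_eq_add_of_lt h
        rw [show n + k + 1 - n = k + 1 by omega, show n + k + 1 - (n + 1) = k by omega]
        rfl
  obtain ⟨n, hn⟩ := hloc κ₀ hmono
  classical
  -- One term more than needed is fixed, so that the current level is `blk (κ₀ n)` and the
  -- continuation stays increasing even if `n = 0`.
  refine (st (n + 1)).2 fun H hH => ⟨H, subset_rfl, hH, decide (G κ₀), fun κ hκ => ?_⟩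
  refine (hst (n + 1) κ).trans ?_
  rw [hn _ ?_ fun j hj => if_pos (by omega), decide_eq_true_iff]
  intro j j' hjj
  simp only
  have h1 : ∀ i, blk (κ₀ n) < blk (κ i) := hκ.2.1
  split_ifs with h h' h'
  · exact hmono hjj
  · exact lt_of_le_of_lt (hmono.monotone (by omega : j ≤ n)) (h1 _)
  · omega
  · exact hκ.2.2 (by omega)

end Ramsey

/-! ### Initial segments whose norm exceeds the `l_p` norm. -/

section ExceedingLp

variable {𝕜 : Type v} [RCLike 𝕜] {X : Type u} [NormedAddCommGroup X] [NormedSpace 𝕜 X]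

/-- Some combination of the first `m` terms of `y` has norm larger than `T` times the `l_p` norm of
its coefficients. -/
def ExceedsLp (𝕜 : Type v) {X : Type u} [RCLike 𝕜] [NormedAddCommGroup X] [NormedSpace 𝕜 X]
    (p T : ℝ) (y : ℕ → X) (m : ℕ) : Prop :=
  ∃ t : ℕ → 𝕜, T * finLpNorm p (Finset.range m) t < ‖∑ i ∈ Finset.range m, t i • y i‖

theorem ExceedsLp.mono {p T : ℝ} (hp : 1 ≤ p) {y : ℕ → X} {m m' : ℕ} (hm : m ≤ m')
    (h : ExceedsLp 𝕜 p T y m) : ExceedsLp 𝕜 p T y m' := by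
  obtain ⟨t, ht⟩ := h
  have hsub : Finset.range m ⊆ Finset.range m' := Finset.range_mono hm
  refine ⟨fun i => if i ∈ Finset.range m then t i else 0, ?_⟩
  rwa [finLpNorm_ite hp hsub, sum_ite_smul_of_subset hsub]

theorem ExceedsLp.congr {p T : ℝ} {y y' : ℕ → X} {m : ℕ} (hy : ∀ i < m, y i = y' i)
    (h : ExceedsLp 𝕜 p T y m) : ExceedsLp 𝕜 p T y' m := by
  obtain ⟨t, ht⟩ := h
  have e : ∑ i ∈ Finset.range m, t i • y' i = ∑ i ∈ Finset.range m, t i • y i :=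
    Finset.sum_congr rfl fun i hi => by rw [hy i (Finset.mem_range.1 hi)]
  exact ⟨t, by rwa [e]⟩

theorem ExceedsLp.anti {p T T' : ℝ} {y : ℕ → X} {m : ℕ} (hT : T ≤ T')
    (h : ExceedsLp 𝕜 p T' y m) : ExceedsLp 𝕜 p T y m := by
  obtain ⟨t, ht⟩ := h
  exact ⟨t, lt_of_le_of_lt (mul_le_mul_of_nonneg_right hT (finLpNorm_nonneg _ _ _)) ht⟩

theorem not_exceedsLp_zero {p T : ℝ} (hp : 1 ≤ p) (y : ℕ → X) : ¬ ExceedsLp 𝕜 p T y 0 := by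
  rintro ⟨t, ht⟩
  simp [finLpNorm_empty hp] at ht

/-- Removing the first term. -/
theorem ExceedsLp.tail {p T c : ℝ} (hp : 1 ≤ p) (hT : 0 ≤ T) {y : ℕ → X} (hy : ‖y 0‖ ≤ c)
    {m : ℕ} (h : ExceedsLp 𝕜 p (T + c) y (m + 1)) :
    ExceedsLp 𝕜 p T (fun i => y (i + 1)) m := by
  obtain ⟨t, ht⟩ := h
  refine ⟨fun i => t (i + 1), ?_⟩
  rw [Finset.sum_range_succ'] at ht
  have h1 := norm_add_le (∑ i ∈ Finset.range m, t (i + 1) • y (i + 1)) (t 0 • y 0)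
  have h2 : ‖t 0 • y 0‖ ≤ finLpNorm p (Finset.range (m + 1)) t * c := by
    rw [norm_smul]
    exact mul_le_mul (norm_le_finLpNorm hp (Finset.mem_range.2 (Nat.succ_pos m)) t) hy
      (norm_nonneg _) (finLpNorm_nonneg _ _ _)
  have h3 : finLpNorm p (Finset.range m) (fun i => t (i + 1)) ≤
      finLpNorm p (Finset.range (m + 1)) t := by
    have := finLpNorm_map p (Finset.range m) ⟨Nat.succ, Nat.succ_injective⟩ t
    refine (le_of_eq this.symm).trans (finLpNorm_mono hp (fun i hi => ?_) t)
    obtain ⟨j, hj, rfl⟩ := Finset.mem_map.1 hi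
    exact Finset.mem_range.2 (Nat.succ_lt_succ (Finset.mem_range.1 hj))
  have h4 := mul_le_mul_of_nonneg_left h3 hT
  linarith

end ExceedingLp

/-! ### Separation when no subsequence is dominated by `l_p`. -/

section NotDominated

variable {𝕜 : Type v} [RCLike 𝕜] {X : Type u} [NormedAddCommGroup X] [NormedSpace 𝕜 X]
  {α : Type*}

/-- Before the even terms of `κ` exceed `l_p` by the factor `S`, the odd terms exceed it by the
factor `T`. -/
def OddTermsExceedFirst (𝕜 : Type v) {X : Type u} [RCLike 𝕜] [NormedAddCommGroup X]
    [NormedSpace 𝕜 X] {α : Type*} (p S T : ℝ) (x : α → X) (κ : ℕ → α) : Prop :=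
  ∃ m, ExceedsLp 𝕜 p T (fun j => x (κ (2 * j + 1))) m ∧ ¬ ExceedsLp 𝕜 p S (fun j => x (κ (2 * j))) m

/-- Only the first time at which the odd terms exceed matters, because exceeding is monotone in
length; this makes the property depend on finitely many terms. -/
theorem oddTermsExceedFirst_iff {p S T : ℝ} (hp : 1 ≤ p) {x : α → X} {κ : ℕ → α} {m : ℕ}
    (hm : ExceedsLp 𝕜 p T (fun j => x (κ (2 * j + 1))) m)
    (hmin : ∀ k < m, ¬ ExceedsLp 𝕜 p T (fun j => x (κ (2 * j + 1))) k) :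
    OddTermsExceedFirst 𝕜 p S T x κ ↔ ¬ ExceedsLp 𝕜 p S (fun j => x (κ (2 * j))) m := by
  refine ⟨fun ⟨k, hk, hkS⟩ h => hkS (h.mono hp ?_), fun h => ⟨m, hm, h⟩⟩
  exact not_lt.1 fun hlt => hmin k hlt hk

/-- In families without dominated subsequences, some large set has the property that for all its
transversals the odd terms exceed `l_p` first. -/
theorem exists_large_oddTermsExceedFirst {p c T : ℝ} (hp : 1 ≤ p) (hT : 0 ≤ T)
    {blk : α → ℕ} {x : α → X} (hxc : ∀ a, ‖x a‖ ≤ c) (hlarge : IsLargeSet blk Set.univ)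
    (hexc : ∀ κ : ℕ → α, Function.Injective κ → ∃ m, ExceedsLp 𝕜 p T (fun i => x (κ i)) m) :
    ∃ H, IsLargeSet blk H ∧ ∀ κ, IsTransversal blk H 0 κ →
      OddTermsExceedFirst 𝕜 p (T + c) T x κ := by
  classical
  have hfirst : ∀ κ : ℕ → α, StrictMono (fun j => blk (κ j)) → ∃ m,
      ExceedsLp 𝕜 p T (fun j => x (κ (2 * j + 1))) m ∧
      ∀ k < m, ¬ ExceedsLp 𝕜 p T (fun j => x (κ (2 * j + 1))) k := by
    intro κ hκ
    have hex := hexc (fun j => κ (2 * j + 1)) fun i j h => by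
      have := hκ.injective (congrArg blk h)
      omega
    exact ⟨Nat.find hex, Nat.find_spec hex, fun k hk => Nat.find_min hex hk⟩
  obtain ⟨H, -, hH, b, hb⟩ := isRamseyBeyond_of_locally_determined (blk := blk)
    (G := OddTermsExceedFirst 𝕜 p (T + c) T x) (fun κ hκ => by
      obtain ⟨m, hm, hmin⟩ := hfirst κ hκ
      refine ⟨2 * m, fun κ' _ hag => ?_⟩
      have hodd : ∀ k ≤ m, ∀ j < k, x (κ (2 * j + 1)) = x (κ' (2 * j + 1)) := fun k hk j hj => by
        rw [hag _ (by omega)]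
      have heven : ∀ j < m, x (κ (2 * j)) = x (κ' (2 * j)) := fun j hj => by
        rw [hag _ (by omega)]
      rw [oddTermsExceedFirst_iff hp hm hmin, oddTermsExceedFirst_iff hp
        (hm.congr (hodd m le_rfl)) fun k hk h => hmin k hk
          (h.congr fun j hj => (hodd k hk.le j hj).symm)]
      exact not_congr ⟨fun h => h.congr fun j hj => (heven j hj).symm, fun h => h.congr heven⟩)
    Set.univ hlarge
  refine ⟨H, hH, ?_⟩
  cases b with
  | true => exact fun κ hκ => (hb κ hκ).2 rfl
  | false =>
    exfalso
    -- In the negative case the property fails for `κ` and for its shift. If the odd terms first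
    -- exceed `T` at time `k + 1`, the even terms exceed `T + c` there; without their first term
    -- they exceed `T` at time `k`. They are the odd terms of the shift, so its even terms, the odd
    -- terms of `κ`, exceed at time `k`, against minimality.
    obtain ⟨κ, hκ⟩ := hH.exists_transversal 0
    have h0 := mt (hb κ hκ).1 (by simp)
    have h1 := mt (hb (fun j => κ (j + 1)) ⟨fun j => hκ.1 _, fun j => hκ.2.1 _,
      fun i j h => hκ.2.2 (Nat.succ_lt_succ h)⟩).1 (by simp)
    obtain ⟨m, hm, hmin⟩ := hfirst κ hκ.2.2
    cases m with
    | zero => exact not_exceedsLp_zero hp _ hm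
    | succ k =>
      have h2 : ExceedsLp 𝕜 p (T + c) (fun j => x (κ (2 * j))) (k + 1) := by
        by_contra h
        exact h0 ⟨k + 1, hm, h⟩
      have h3 := h2.tail hp hT (hxc _)
      have h4 : ExceedsLp 𝕜 p (T + c) (fun j => x (κ (2 * j + 1))) k := by
        by_contra h
        exact h1 ⟨k, h3, h⟩
      have hc : 0 ≤ c := (norm_nonneg _).trans (hxc (κ 0))
      exact hmin k (Nat.lt_succ_self k) (h4.anti (by linarith))

/-- Separating configurations in families without subsequences that are dominated by `l_p`. -/
theorem hasSeparatingConfiguration_of_not_dominated {p c : ℝ} (hp : 1 ≤ p) (hc : 1 ≤ c)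
    {blk : α → ℕ} {x : α → X} (hB : IsBlockFamily 𝕜 p c blk x)
    (hlarge : IsLargeSet blk Set.univ)
    (hsingle : ∀ κ : ℕ → α, Function.Injective κ → ∀ C : ℝ, ∃ (s : Finset ℕ) (t : ℕ → 𝕜),
      C * finLpNorm p s t < ‖∑ i ∈ s, t i • x (κ i)‖)
    (R : ℝ) (V : Finset α) : HasSeparatingConfiguration 𝕜 x R V := by
  refine HasSeparatingConfiguration.mono (le_max_left R 1) ?_
  set M := max R 1
  have hM : 1 ≤ M := le_max_right _ _
  have hc0 : 0 < c := by linarith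
  have hM0 : 0 < M := by linarith
  -- Now `g` wins on points, `D` on rows and `B` on branches. On a branch `w₂ * T = 4 * M * c`,
  -- while `w₃ * (T + c) = w₂ * c` keeps the layer `D` within `c` times the `l_p` norm.
  set w₂ : ℝ := 1 / (4 * M * c ^ 2) with hw₂
  have hw₂0 : 0 < w₂ := by positivity
  set T : ℝ := 4 * M * c / w₂ with hT
  have hT0 : 0 < T := by positivity
  set w₃ : ℝ := w₂ * c / (T + c) with hw₃
  have hw₃0 : 0 < w₃ := by positivity
  have hc2 : 1 ≤ c ^ 2 := one_le_pow₀ hc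
  have hw₂1 : w₂ ≤ 1 := by
    rw [hw₂]; exact div_le_one_of_le₀ (by nlinarith) (by positivity)
  have hw₃₂ : w₃ ≤ w₂ := by
    rw [hw₃, mul_div_assoc]
    exact mul_le_of_le_one_right hw₂0.le (div_le_one_of_le₀ (by linarith) (by positivity))
  have hexc : ∀ κ : ℕ → α, Function.Injective κ → ∀ C, ∃ n, 0 < n ∧
      ExceedsLp 𝕜 p C (fun i => x (κ i)) n := by
    intro κ hκ C
    obtain ⟨s, t, hst⟩ := hsingle κ hκ C
    obtain ⟨n, hn, t', h1, h2⟩ := exists_initial_segment hp (fun i => x (κ i)) s t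
    exact ⟨n, hn, t', by rwa [h1, h2]⟩
  obtain ⟨H, hH, hgood⟩ := exists_large_oddTermsExceedFirst (𝕜 := 𝕜) hp hT0.le
    (fun a => (hB.norm_le hp a).2) hlarge fun κ hκ => by
      obtain ⟨n, -, h⟩ := hexc κ hκ T
      exact ⟨n, h⟩
  obtain ⟨n, D, B, hrow, hP⟩ := exists_rowSystem hH
    (fun κ n => ExceedsLp 𝕜 p (2 * M * c / w₃) (fun i => x (κ i)) n) (fun m => by
      obtain ⟨κ, hκ⟩ := hH.exists_transversal m
      exact ⟨κ, fun i => ⟨hκ.1 i, hκ.2.1 i⟩, hκ.injective, hexc κ hκ.injective _⟩) (V.sup blk)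
  obtain ⟨N, hN⟩ := exists_bound_of_forall_branch n hrow.pos
    (fun m f => ExceedsLp 𝕜 p T (fun y => x (B y (f y))) m ∧
      ¬ ExceedsLp 𝕜 p (T + c) (fun y => x (D y (f y))) m)
    (fun m f g hfg ⟨h1, h2⟩ => ⟨h1.congr fun y hy => by rw [hfg y hy],
      fun h => h2 (h.congr fun y hy => by rw [hfg y hy])⟩)
    (fun f hf => by
      -- A branch interlaced as `D, B, D, B, …` is a transversal of `H`: its even terms are the `D`
      -- entries and its odd terms the `B` entries.
      let κ : ℕ → α := fun j => if j % 2 = 0 then D (j / 2) (f (j / 2)) else B (j / 2) (f (j / 2))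
      have he : ∀ j, κ (2 * j) = D j (f j) := fun j => by
        simp [κ]
      have ho : ∀ j, κ (2 * j + 1) = B j (f j) := fun j => by
        simp only [κ]
        rw [if_neg (by omega), show (2 * j + 1) / 2 = j by omega]
      have hmono : StrictMono fun j => blk (κ j) := strictMono_nat_of_lt_succ fun j => by
        rcases Nat.even_or_odd' j with ⟨k, rfl | rfl⟩
        · rw [he, ho]
          exact hrow.ltDB k _ (hf k) _ (hf k)
        · rw [ho, show 2 * k + 1 + 1 = 2 * (k + 1) by ring, he]
          exact hrow.ltBD k (k + 1) (Nat.lt_succ_self k) _ (hf k) _ (hf _)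
      obtain ⟨m, h1, h2⟩ := hgood κ ⟨fun j => by
        rcases Nat.even_or_odd' j with ⟨k, rfl | rfl⟩
        · rw [he]
          exact hrow.memD k _ (hf k)
        · rw [ho]
          exact hrow.memB k _ (hf k), fun j => by
        have h0 := hrow.beyond 0 _ (hf 0)
        rw [← he] at h0
        exact lt_of_lt_of_le (lt_of_le_of_lt (Nat.zero_le _) h0) (hmono.monotone (Nat.zero_le j)),
        hmono⟩
      simp only [he, ho] at h1 h2
      exact ⟨m, h1, h2⟩)
  obtain ⟨g, hg, hgB, hgblk⟩ := hlarge.exists_last_block (rowIndex n N) fun q => B q.1 q.2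
  refine hasSeparatingConfiguration_of_rows x M V hrow N g hg hgB ![w₃, w₂, 1] ?_ 2 0 1
    (fun i => by fin_cases i <;> simp) ?_ ?_ ?_
  · intro i
    fin_cases i <;> simp [hw₃0, hw₂0]
  · intro q _
    refine ⟨fun _ => 1, ?_⟩
    rw [sum_erase_fin_three]
    simp
    have hG := (hB.norm_le hp (g q)).1
    have hBn := mul_le_mul_of_nonneg_left (hB.norm_le hp (B q.1 q.2)).2 hw₂0.le
    have hD := mul_le_mul_of_nonneg_left (hB.norm_le hp (D q.1 q.2)).2 hw₃0.le
    have h1 := mul_le_mul_of_nonneg_right hw₃₂ hc0.le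
    have h2 : M * (w₂ * c + w₂ * c) = c⁻¹ / 2 := by
      rw [hw₂]; field_simp; norm_num
    have h3 : 0 < c⁻¹ := inv_pos.2 hc0
    have h4 := mul_le_mul_of_nonneg_left
      (by linarith : w₃ * ‖x (D q.1 q.2)‖ + w₂ * ‖x (B q.1 q.2)‖ ≤ w₂ * c + w₂ * c) hM0.le
    linarith
  · intro y hy
    obtain ⟨t, ht⟩ := hP y
    refine ⟨fun q => t q.2, ?_⟩
    rw [sum_erase_fin_three]
    simp only [Finset.sum_map, Function.Embedding.coeFn_mk]
    simp
    have hidx : ∀ i ∈ Finset.range (n y), (y, i) ∈ rowIndex n N := fun i hi =>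
      mem_rowIndex.2 ⟨hy, Finset.mem_range.1 hi⟩
    have hBn := (hB.comp (Finset.range (n y)) (fun i => B y i)
      (fun i hi j hj => hrow.injB y i (Finset.mem_range.1 hi) j (Finset.mem_range.1 hj))
      (fun i hi j hj => hrow.blkB y i (Finset.mem_range.1 hi) j (Finset.mem_range.1 hj)) t).2
    have hG := (hB.comp (Finset.range (n y)) (fun i => g (y, i))
      (fun i hi j hj h => (Prod.mk.inj (hg _ (hidx i hi) _ (hidx j hj) h)).2)
      (fun i hi j hj => hgblk _ (hidx i hi) _ (hidx j hj)) t).2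
    have hL : 0 ≤ finLpNorm p (Finset.range (n y)) t := finLpNorm_nonneg _ _ _
    set Lp := finLpNorm p (Finset.range (n y)) t
    have h1 : w₃ * (2 * M * c / w₃ * Lp) = M * (c * Lp + c * Lp) := by
      field_simp; ring
    have h2 := mul_lt_mul_of_pos_left ht hw₃0
    have h3 := (mul_le_of_le_one_left (norm_nonneg
      (∑ i ∈ Finset.range (n y), t i • x (B y i))) hw₂1).trans hBn
    have h4 := mul_le_mul_of_nonneg_left (add_le_add h3 hG) hM0.le
    linarith
  · intro f hf
    obtain ⟨m, hm, ⟨t, ht⟩, hnot⟩ := hN f hf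
    refine ⟨m, hm, fun q => t q.1, ?_⟩
    rw [sum_erase_fin_three]
    simp only [sum_graphIndex]
    simp
    have hlt : ∀ y ∈ Finset.range m, y < N := fun y hy =>
      lt_of_lt_of_le (Finset.mem_range.1 hy) hm
    have hidx : ∀ y ∈ Finset.range m, (y, f y) ∈ rowIndex n N := fun y hy =>
      mem_rowIndex.2 ⟨hlt y hy, hf y (hlt y hy)⟩
    have hG := (hB.comp (Finset.range m) (fun y => g (y, f y))
      (fun y hy y' hy' h => (Prod.mk.inj (hg _ (hidx y hy) _ (hidx y' hy') h)).1)
      (fun y hy y' hy' => hgblk _ (hidx y hy) _ (hidx y' hy')) t).2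
    have hD : ‖∑ y ∈ Finset.range m, t y • x (D y (f y))‖ ≤
        (T + c) * finLpNorm p (Finset.range m) t := not_lt.1 fun h => hnot ⟨t, h⟩
    have hL : 0 ≤ finLpNorm p (Finset.range m) t := finLpNorm_nonneg _ _ _
    set Lp := finLpNorm p (Finset.range m) t
    have h1 : w₂ * (T * Lp) = M * (4 * (c * Lp)) := by
      rw [hT]; field_simp
    have h2 := mul_lt_mul_of_pos_left ht hw₂0
    have h3 : w₃ * ((T + c) * Lp) = w₂ * (c * Lp) := by
      rw [hw₃]; field_simp
    have hcL : 0 ≤ c * Lp := by positivity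
    have h4 := mul_le_mul_of_nonneg_left hD hw₃0.le
    have h5 := mul_le_of_le_one_left hcL hw₂1
    have h6 : w₃ * ‖∑ y ∈ Finset.range m, t y • x (D y (f y))‖ +
        ‖∑ y ∈ Finset.range m, t y • x (g (y, f y))‖ ≤ 4 * (c * Lp) := by linarith
    have h7 := mul_le_mul_of_nonneg_left h6 hM0.le
    linarith

end NotDominated

/-! ### Disjoint blocks from crude finite sequence representability. -/

section Extraction

variable {𝕜 : Type v} [RCLike 𝕜] {X : Type u} [NormedAddCommGroup X] [NormedSpace 𝕜 X]

theorem IsEquivalentToLpOn.subset {C p : ℝ} (hp : 1 ≤ p) {A B : Finset ℕ} (h : A ⊆ B)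
    {y : ℕ → X} (hB : IsEquivalentToLpOn 𝕜 C p B y) : IsEquivalentToLpOn 𝕜 C p A y := by
  intro t
  have h1 := hB fun i => if i ∈ A then t i else 0
  rw [sum_ite_smul_of_subset h] at h1
  have h2 := finLpNorm_ite hp h t
  change C⁻¹ * finLpNorm p B _ ≤ _ ∧ _ ≤ C * finLpNorm p B _ at h1
  rw [h2] at h1
  exact h1

theorem IsCrudelyFinitelySequenceRepresentable.exists_disjoint {p : ℝ} (hp : 1 ≤ p) {y : ℕ → X}
    (h : IsCrudelyFinitelySequenceRepresentable 𝕜 p y) :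
    ∃ C : ℝ, 1 ≤ C ∧ ∃ A : ℕ → Finset ℕ, (∀ n, (A n).card = n) ∧
      (∀ m n, m < n → Disjoint (A m) (A n)) ∧ ∀ n, IsEquivalentToLpOn 𝕜 C p (A n) y := by
  obtain ⟨C, hC, hB⟩ := h
  obtain ⟨A, V, hA, -, hV⟩ := exists_seq_of_forall_finset (γ := Finset ℕ) (fun A => A)
    (fun n V A => A.card = n ∧ Disjoint V A ∧ IsEquivalentToLpOn 𝕜 C p A y) (fun n V => by
      -- At least `n` elements remain after `V` is removed, and subsets inherit the equivalence
      -- constant.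
      obtain ⟨B, hBc, hBe⟩ := hB (n + V.card)
      obtain ⟨A, hAB, hAc⟩ := Finset.exists_subset_card_eq
        (show n ≤ (B \ V).card by have := Finset.le_card_sdiff V B; omega)
      exact ⟨A, hAc, (Finset.disjoint_of_subset_left hAB Finset.sdiff_disjoint).symm,
        hBe.subset hp (hAB.trans Finset.sdiff_subset)⟩) ∅
  exact ⟨C, hC, A, fun n => (hA n).1,
    fun m n hmn => Finset.disjoint_of_subset_left (hV m n hmn) (hA n).2.1, fun n => (hA n).2.2⟩

/-- Crude finite sequence representability provides disjoint blocks of all lengths. -/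
theorem IsCrudelyFinitelySequenceRepresentable.exists_blockFamily {p : ℝ} (hp : 1 ≤ p) {y : ℕ → X}
    (h : IsCrudelyFinitelySequenceRepresentable 𝕜 p y) :
    ∃ C : ℝ, 1 ≤ C ∧ ∃ g : (Σ n : ℕ, Fin n) → ℕ, Function.Injective g ∧
      IsBlockFamily 𝕜 p C Sigma.fst (fun a => y (g a)) := by
  classical
  obtain ⟨C, hC, A, hAc, hdisj, hA⟩ := h.exists_disjoint hp
  let g : (Σ n : ℕ, Fin n) → ℕ := fun a => ((A a.1).equivFinOfCardEq (hAc a.1)).symm a.2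
  have hgA : ∀ a, g a ∈ A a.1 := fun a => (((A a.1).equivFinOfCardEq (hAc a.1)).symm a.2).2
  have hg : Function.Injective g := by
    rintro ⟨n, i⟩ ⟨m, j⟩ hij
    have h1 := hgA ⟨n, i⟩
    have h2 := hgA ⟨m, j⟩
    rw [← hij] at h2
    rcases lt_trichotomy n m with hnm | hnm | hnm
    · exact absurd h2 (Finset.disjoint_left.1 (hdisj n m hnm) h1)
    · subst hnm
      have : i = j := ((A n).equivFinOfCardEq (hAc n)).symm.injective (Subtype.ext hij)
      rw [this]
    · exact absurd h1 (Finset.disjoint_left.1 (hdisj m n hnm) h2)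
  refine ⟨C, hC, g, hg, fun E hE t => ?_⟩
  rcases E.eq_empty_or_nonempty with rfl | ⟨a₀, ha₀⟩
  · simp [finLpNorm_empty hp]
  have : Nonempty (Σ n : ℕ, Fin n) := ⟨a₀⟩
  have hsub : E.image g ⊆ A a₀.1 := by
    intro k hk
    obtain ⟨a, ha, rfl⟩ := Finset.mem_image.1 hk
    rw [← hE a ha a₀ ha₀]
    exact hgA a
  have h1 := (hA a₀.1).subset hp hsub fun k => t (Function.invFun g k)
  change C⁻¹ * finLpNorm p _ _ ≤ _ ∧ _ ≤ C * finLpNorm p _ _ at h1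
  rw [finLpNorm_image p hg.injOn, Finset.sum_image hg.injOn] at h1
  simpa only [Function.leftInverse_invFun hg _] using h1

theorem isLargeSet_sigma_fin : IsLargeSet (Sigma.fst : (Σ n : ℕ, Fin n) → ℕ) Set.univ := by
  intro n
  refine ⟨Finset.univ.map ⟨Sigma.mk n, sigma_mk_injective⟩, Set.subset_univ _, by simp, n, le_rfl,
    fun a ha => ?_⟩
  obtain ⟨i, -, rfl⟩ := Finset.mem_map.1 ha
  rfl

theorem IsDominatedByLp.comp {p : ℝ} {y : ℕ → X} (h : IsDominatedByLp 𝕜 p y) {ρ : ℕ → ℕ}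
    (hρ : Function.Injective ρ) : IsDominatedByLp 𝕜 p (fun i => y (ρ i)) := by
  obtain ⟨C, hC⟩ := h
  refine ⟨C, fun s t => ?_⟩
  have h1 := hC (s.map ⟨ρ, hρ⟩) fun k => t (Function.invFun ρ k)
  change _ ≤ C * finLpNorm p _ _ at h1
  rw [finLpNorm_map, Finset.sum_map] at h1
  simp only [Function.Embedding.coeFn_mk, Function.leftInverse_invFun hρ _] at h1
  exact h1

theorem DominatesLp.comp {p : ℝ} {y : ℕ → X} (h : DominatesLp 𝕜 p y) {ρ : ℕ → ℕ}
    (hρ : Function.Injective ρ) : DominatesLp 𝕜 p (fun i => y (ρ i)) := by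
  obtain ⟨C, hC⟩ := h
  refine ⟨C, fun s t => ?_⟩
  have h1 := hC (s.map ⟨ρ, hρ⟩) fun k => t (Function.invFun ρ k)
  change finLpNorm p _ _ ≤ _ at h1
  rw [finLpNorm_map, Finset.sum_map] at h1
  simp only [Function.Embedding.coeFn_mk, Function.leftInverse_invFun hρ _] at h1
  exact h1

theorem IsDominatedByLp.add {p : ℝ} {y z : ℕ → X} (hy : IsDominatedByLp 𝕜 p y)
    (hz : IsDominatedByLp 𝕜 p z) : IsDominatedByLp 𝕜 p (fun i => y i + z i) := by
  obtain ⟨C, hC⟩ := hy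
  obtain ⟨C', hC'⟩ := hz
  refine ⟨C + C', fun s t => ?_⟩
  simp only [smul_add, Finset.sum_add_distrib]
  exact (norm_add_le _ _).trans ((add_le_add (hC s t) (hC' s t)).trans_eq (add_mul _ _ _).symm)

end Extraction

/-! ### The two alternatives and the conclusion. -/

section MainTheorem

variable {𝕜 : Type v} [RCLike 𝕜] {X : Type u} [NormedAddCommGroup X] [NormedSpace 𝕜 X]

/-- Under domination, a disjoint sequence of single vectors or pair sums that dominates `l_p` would
be equivalent to it, which `hdisj` excludes. -/
theorem exists_subspace_of_dominated (e : SchauderBasis 𝕜 X)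
    (he : IsUnconditionalWith 𝕜 1 (fun l => e l)) {p : ℝ} (hp : 1 ≤ p)
    (hdisj : ∀ L : ℕ → Finset ℕ, (∀ j, (L j).card ≤ 3) →
      Pairwise (fun i j => Disjoint (L i) (L j)) →
      ¬ IsEquivalentToLp 𝕜 p (fun j => ∑ l ∈ L j, e l))
    {φ : ℕ → ℕ} (hφ : Function.Injective φ)
    (hrep : IsCrudelyFinitelySequenceRepresentable 𝕜 p (fun j => e (φ j)))
    (hdom : IsDominatedByLp 𝕜 p (fun j => e (φ j))) :
    ∃ Y : Submodule 𝕜 X, IsClosed (Y : Set X) ∧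
      ¬ HasLocalUnconditionalStructure 𝕜 Y ∧ HasUnconditionalDecomposition 𝕜 Y 2 := by
  obtain ⟨C, hC, g, hg, hblk⟩ := hrep.exists_blockFamily hp
  have hdom' : ∀ κ : ℕ → Σ n : ℕ, Fin n, Function.Injective κ →
      IsDominatedByLp 𝕜 p (fun j => e (φ (g (κ j)))) := fun κ hκ =>
    hdom.comp (ρ := fun j => g (κ j)) (hg.comp hκ)
  refine exists_subspace_of_separatingConfigurations e he (fun a => φ (g a)) (hφ.comp hg)
    (hasSeparatingConfiguration_of_not_dominates hp hC
      (he.comp_injective (hφ.comp hg)) hblk isLargeSet_sigma_fin ?_ ?_)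
  · intro κ hκ K
    by_contra! hcon
    refine hdisj (fun j => {φ (g (κ j))}) (fun j => by simp) (fun i j hij => ?_) ?_
    · exact Finset.disjoint_singleton.2 fun h => hij (hκ (hg (hφ h)))
    · simp only [Finset.sum_singleton]
      exact ⟨⟨K, hcon⟩, hdom' κ hκ⟩
  · intro κ κ' hκ K
    by_contra! hcon
    have hinj : Function.Injective (fun q => φ (g (Sum.elim κ κ' q))) := (hφ.comp hg).comp hκ
    have hne : ∀ i j, φ (g (κ i)) ≠ φ (g (κ' j)) := fun i j h =>
      Sum.inl_ne_inr (hinj (a₁ := Sum.inl i) (a₂ := Sum.inr j) h)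
    have hκ₁ : Function.Injective κ := fun i j h =>
      Sum.inl_injective (hκ (a₁ := Sum.inl i) (a₂ := Sum.inl j) h)
    have hκ₂ : Function.Injective κ' := fun i j h =>
      Sum.inr_injective (hκ (a₁ := Sum.inr i) (a₂ := Sum.inr j) h)
    refine hdisj (fun j => {φ (g (κ j)), φ (g (κ' j))}) (fun j => ?_) (fun i j hij => ?_) ?_
    · exact Finset.card_le_two.trans (by norm_num)
    · simp only [Finset.disjoint_insert_left, Finset.disjoint_singleton_left, Finset.mem_insert,
        Finset.mem_singleton, not_or]
      exact ⟨⟨fun h => hij (hκ₁ (hg (hφ h))), hne i j⟩, fun h => hne j i h.symm,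
        fun h => hij (hκ₂ (hg (hφ h)))⟩
    · have hsum : (fun j => ∑ l ∈ ({φ (g (κ j)), φ (g (κ' j))} : Finset ℕ), e l) =
          fun j => e (φ (g (κ j))) + e (φ (g (κ' j))) :=
        funext fun j => Finset.sum_pair (hne j j)
      rw [hsum]
      exact ⟨⟨K, hcon⟩, (hdom' κ hκ₁).add (hdom' κ' hκ₂)⟩

theorem exists_subspace_of_not_dominated (e : SchauderBasis 𝕜 X)
    (he : IsUnconditionalWith 𝕜 1 (fun l => e l)) {p : ℝ} (hp : 1 ≤ p)
    (hrep : IsCrudelyFinitelySequenceRepresentable 𝕜 p (fun l => e l))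
    (hdom : ∀ κ : ℕ → ℕ, Function.Injective κ → ¬ IsDominatedByLp 𝕜 p (fun j => e (κ j))) :
    ∃ Y : Submodule 𝕜 X, IsClosed (Y : Set X) ∧
      ¬ HasLocalUnconditionalStructure 𝕜 Y ∧ HasUnconditionalDecomposition 𝕜 Y 2 := by
  obtain ⟨C, hC, g, hg, hblk⟩ := hrep.exists_blockFamily hp
  refine exists_subspace_of_separatingConfigurations e he g hg
    (hasSeparatingConfiguration_of_not_dominated hp hC hblk isLargeSet_sigma_fin fun κ hκ K => ?_)
  by_contra! hcon
  exact hdom (fun j => g (κ j)) (hg.comp hκ) ⟨K, hcon⟩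

end MainTheorem

theorem corollary4p4 {𝕜 : Type v} {X : Type u} [RCLike 𝕜] [NormedAddCommGroup X]
    [NormedSpace 𝕜 X] [CompleteSpace X]
    (r : ℝ) (hr : 2 ≤ r) (hX : HasCotype X r)
    (e : SchauderBasis 𝕜 X) (he : IsUnconditionalWith 𝕜 1 (fun l => e l))
    (p : ℝ) (hp : 1 ≤ p)
    (hdisj : ∀ L : ℕ → Finset ℕ, (∀ j, (L j).card ≤ 3) → Pairwise (fun i j => Disjoint (L i) (L j)) →
      ¬ IsEquivalentToLp 𝕜 p (fun j => ∑ l ∈ L j, e l))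
    (hrep :
      (IsCrudelyFinitelySequenceRepresentable 𝕜 p (fun l => e l) ∧
        (IsDominatedByLp 𝕜 p (fun l => e l) ∨ DominatesLp 𝕜 p (fun l => e l))) ∨
      (∀ φ : ℕ → ℕ, StrictMono φ →
        IsCrudelyFinitelySequenceRepresentable 𝕜 p (fun j => e (φ j)))) :
    ∃ Y : Submodule 𝕜 X, IsClosed (Y : Set X) ∧
      ¬ HasLocalUnconditionalStructure 𝕜 Y ∧ HasUnconditionalDecomposition 𝕜 Y 2 := by
  rcases hrep with ⟨hrep, hdom | hdom⟩ | hrep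
  · exact exists_subspace_of_dominated e he hp hdisj Function.injective_id hrep hdom
  · refine exists_subspace_of_not_dominated e he hp hrep fun κ hκ hκdom => ?_
    refine hdisj (fun j => {κ j}) (fun j => by simp)
      (fun i j hij => Finset.disjoint_singleton.2 fun h => hij (hκ h)) ?_
    simp only [Finset.sum_singleton]
    exact ⟨hdom.comp hκ, hκdom⟩
  · by_cases h : ∃ φ : ℕ → ℕ, StrictMono φ ∧ IsDominatedByLp 𝕜 p (fun j => e (φ j))
    · obtain ⟨φ, hφ, hdom⟩ := h
      exact exists_subspace_of_dominated e he hp hdisj hφ.injective (hrep φ hφ) hdom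
    · refine exists_subspace_of_not_dominated e he hp (hrep id strictMono_id) fun κ hκ hκdom => ?_
      -- An injective sequence of indices has a strictly increasing subsequence, and domination
      -- passes to it.
      obtain ⟨ψ, hψ, hκψ⟩ := strictMono_subseq_of_tendsto_atTop hκ.nat_tendsto_atTop
      exact h ⟨fun j => κ (ψ j), hκψ, hκdom.comp hψ.injective⟩
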